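/- Let $G=SL_2(\mathbb{R})$, let $\Gamma\le G$ be a lattice (a discrete subgroup such that $G/\Gamma$ carries a $G$-invariant Borel probability measure), let $X=G/\Gamma$, let $\mu$ be the unique $G$-invariant Borel probability measure on $X$, and let $u_t=\begin{pmatrix}1&t\\0&1\end{pmatrix}$ act on $X$ by left multiplication (the horocycle flow). Equip $X$ with the quotient $d_X(x,y)=\inf\{d_G(g,h) : g\Gamma=x,\ h\Gamma=y\}$ of the distance $d_G$ of a right-invariant Riemannian metric on $G$, say the one given by $\langle A,B\rangle=\operatorname{tr}(A^{T}B)$ on the Lie algebra (all choices give bi-Lipschitz equivalent distances). For every $d\in\mathbb{N}$ and every $\alpha>0$ there is a constant $\alpha'=\alpha'(d,\alpha,\Gamma)>0$ with the following property. Let $f:X\to\mathbb{C}$ be a bounded Lipschitz function with $\int_X f\,d\mu=0$ for which the flow is polynomially mixing with rate $\alpha$, that is, there is a constant $C_f$ with $$\left|\int_X f(u_n x)\,\overline{f(x)}\,d\mu(x)\right|\le C_f\, n^{-\alpha}\qquad\text{for all integers } n\ge 1.$$ Let $a_1<a_2<\cdots$ be a strictly increasing sequence of natural numbers that grows polynomially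 with rate $d$, that is, there is a constant $C>0$ with $a_n\le C n^{d}$ for all $n\ge1$. Then $$\dim_H\left\{x\in X : \limsup_{N\to\infty}\left|\frac1N\sum_{n=1}^{N} f(u_{a_n}x)\right|>0\right\}\le 3-\frac{\alpha'}{d},$$ where $\dim_H$ is the Hausdorff dimension with respect to $d_X$. (For $d=0$ no such sequence exists.) -/

import Mathlib

open MeasureTheory Filter Topology
open scoped MatrixGroups ENNReal NNReal ComplexConjugate

namespace Horocycle

/-! ### The right-invariant Riemannian distance on `SL(2, ℝ)` -/

section Metric

-- The norm of a matrix in this section is the Frobenius norm `√(∑ i, j, |A i j| ^ 2)`.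
attribute [local instance] Matrix.frobeniusNormedAddCommGroup Matrix.frobeniusNormedSpace
  Matrix.frobeniusNormedRing Matrix.frobeniusNormedAlgebra

/-- A `C¹` curve in `SL(2, ℝ)`, i.e. a `C¹` curve of matrices with values in `SL(2, ℝ)`. -/
def IsC1Curve (γ : ℝ → SL(2, ℝ)) : Prop :=
  ContDiff ℝ 1 fun t => (γ t : Matrix (Fin 2) (Fin 2) ℝ)

/-- The speed of a curve for the right-invariant Riemannian metric on `SL(2, ℝ)` that is given
by `⟪A, B⟫ = tr (Aᵀ B)` on the Lie algebra: the Frobenius norm of `γ'(t) γ(t)⁻¹`. -/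
noncomputable def speed (γ : ℝ → SL(2, ℝ)) (t : ℝ) : ℝ :=
  ‖deriv (fun s => (γ s : Matrix (Fin 2) (Fin 2) ℝ)) t *
    ((γ t)⁻¹ : SL(2, ℝ)).1‖

/-- The Riemannian length of the piece of the curve over `[0, 1]`. -/
noncomputable def curveLength (γ : ℝ → SL(2, ℝ)) : ℝ :=
  ∫ t in (0 : ℝ)..1, speed γ t

/-- The right-invariant Riemannian distance on `SL(2, ℝ)`: the infimum of the lengths of the
`C¹` curves from `g` to `h`. (Any other right-invariant Riemannian metric gives a bi-Lipschitz
equivalent distance. It does not matter that the curves are defined on all of `ℝ`: a curve on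
`[0, 1]` can be reparametrized to be constant near its ends.) -/
noncomputable def groupDist (g h : SL(2, ℝ)) : ℝ≥0∞ :=
  ⨅ (γ : ℝ → SL(2, ℝ)) (_ : IsC1Curve γ) (_ : γ 0 = g) (_ : γ 1 = h),
    ENNReal.ofReal (curveLength γ)

/-- The quotient distance on `SL(2, ℝ) ⧸ Γ`: the infimum of the distances of representatives. -/
noncomputable def quotDist (Γ : Subgroup SL(2, ℝ)) (x y : SL(2, ℝ) ⧸ Γ) : ℝ≥0∞ :=
  ⨅ (g : SL(2, ℝ)) (h : SL(2, ℝ)) (_ : (g : SL(2, ℝ) ⧸ Γ) = x) (_ : (h : SL(2, ℝ) ⧸ Γ) = y),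
    groupDist g h

lemma speed_nonneg (γ : ℝ → SL(2, ℝ)) (t : ℝ) : 0 ≤ speed γ t := norm_nonneg _

lemma IsC1Curve.continuous {γ : ℝ → SL(2, ℝ)} (h : IsC1Curve γ) : Continuous γ :=
  continuous_induced_rng.2 (ContDiff.continuous h)

lemma IsC1Curve.continuous_speed {γ : ℝ → SL(2, ℝ)} (h : IsC1Curve γ) :
    Continuous (speed γ) := by
  have h1 : Continuous (deriv fun s => (γ s : Matrix (Fin 2) (Fin 2) ℝ)) :=
    ContDiff.continuous_deriv h le_rfl
  have h2 : Continuous fun t => ((γ t)⁻¹ : SL(2, ℝ)).1 :=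
    continuous_subtype_val.comp h.continuous.inv
  exact (h1.mul h2).norm

lemma IsC1Curve.hasDerivAt {γ : ℝ → SL(2, ℝ)} (h : IsC1Curve γ) (t : ℝ) :
    HasDerivAt (fun s => (γ s : Matrix (Fin 2) (Fin 2) ℝ))
      (deriv (fun s => (γ s : Matrix (Fin 2) (Fin 2) ℝ)) t) t :=
  ((ContDiff.differentiable h one_ne_zero) t).hasDerivAt

lemma speed_congr {γ η : ℝ → SL(2, ℝ)} {t : ℝ} (h : γ =ᶠ[𝓝 t] η) : speed γ t = speed η t := by
  have h1 : (fun s => (γ s : Matrix (Fin 2) (Fin 2) ℝ)) =ᶠ[𝓝 t]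
      fun s => (η s : Matrix (Fin 2) (Fin 2) ℝ) := h.fun_comp _
  have h2 : deriv (fun s => (γ s : Matrix (Fin 2) (Fin 2) ℝ)) t =
      deriv (fun s => (η s : Matrix (Fin 2) (Fin 2) ℝ)) t := h1.deriv_eq
  simp only [speed, h2, h.self_of_nhds]

lemma speed_comp {γ : ℝ → SL(2, ℝ)} (h : IsC1Curve γ) {φ : ℝ → ℝ} {φ' t : ℝ}
    (hφ : HasDerivAt φ φ' t) : speed (fun s => γ (φ s)) t = |φ'| * speed γ (φ t) := by
  have h1 := (h.hasDerivAt (φ t)).scomp t hφ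
  have h2 : deriv (fun s => (γ (φ s) : Matrix (Fin 2) (Fin 2) ℝ)) t =
    φ' • deriv (fun s => (γ s : Matrix (Fin 2) (Fin 2) ℝ)) (φ t) := h1.deriv
  simp only [speed, h2, smul_mul_assoc, norm_smul, Real.norm_eq_abs]

lemma speed_mul_right (γ : ℝ → SL(2, ℝ)) (hγ : IsC1Curve γ) (k : SL(2, ℝ)) (t : ℝ) :
    speed (fun s => γ s * k) t = speed γ t := by
  have h1 : HasDerivAt (fun s => ((γ s * k : SL(2, ℝ)) : Matrix (Fin 2) (Fin 2) ℝ))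
      (deriv (fun s => (γ s : Matrix (Fin 2) (Fin 2) ℝ)) t * k.1) t := by
    simp only [Matrix.SpecialLinearGroup.coe_mul]
    exact (hγ.hasDerivAt t).mul_const k.1
  have h3 : deriv (fun s => ((γ s * k : SL(2, ℝ)) : Matrix (Fin 2) (Fin 2) ℝ)) t =
      deriv (fun s => (γ s : Matrix (Fin 2) (Fin 2) ℝ)) t * k.1 := h1.deriv
  have h2 : k.1 * ((γ t * k)⁻¹ : SL(2, ℝ)).1 = ((γ t)⁻¹ : SL(2, ℝ)).1 := by
    rw [← Matrix.SpecialLinearGroup.coe_mul]; rw [mul_inv_rev, mul_inv_cancel_left]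
  simp only [speed]
  rw [h3, mul_assoc, h2]

lemma IsC1Curve.mul {γ η : ℝ → SL(2, ℝ)} (h : IsC1Curve γ) (h' : IsC1Curve η) :
    IsC1Curve fun t => γ t * η t := by
  have : ContDiff ℝ 1 fun t => (γ t : Matrix (Fin 2) (Fin 2) ℝ) * (η t).1 := ContDiff.mul h h'
  simpa [IsC1Curve] using this

lemma IsC1Curve.const (k : SL(2, ℝ)) : IsC1Curve fun _ => k := contDiff_const

lemma IsC1Curve.comp {γ : ℝ → SL(2, ℝ)} (h : IsC1Curve γ) {φ : ℝ → ℝ} (hφ : ContDiff ℝ 1 φ) :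
    IsC1Curve fun t => γ (φ t) := 
  ContDiff.comp (g := fun t => (γ t : Matrix (Fin 2) (Fin 2) ℝ)) h hφ

lemma groupDist_le {γ : ℝ → SL(2, ℝ)} (h : IsC1Curve γ) :
    groupDist (γ 0) (γ 1) ≤ ENNReal.ofReal (curveLength γ) :=
  iInf_le_of_le γ <| iInf_le_of_le h <| iInf_le_of_le rfl <| iInf_le_of_le rfl le_rfl

lemma exists_curve {g h : SL(2, ℝ)} {r : ℝ≥0∞} (hr : groupDist g h < r) :
    ∃ γ, IsC1Curve γ ∧ γ 0 = g ∧ γ 1 = h ∧ ENNReal.ofReal (curveLength γ) < r := by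
  simpa only [groupDist, iInf_lt_iff, exists_prop] using hr

lemma curveLength_nonneg (γ : ℝ → SL(2, ℝ)) : 0 ≤ curveLength γ :=
  intervalIntegral.integral_nonneg zero_le_one fun t _ => speed_nonneg γ t

lemma groupDist_self (g : SL(2, ℝ)) : groupDist g g = 0 := by
  have h := groupDist_le (IsC1Curve.const g)
  have h1 : deriv (fun _ : ℝ => (g : Matrix (Fin 2) (Fin 2) ℝ)) = 0 := by
    funext t
    exact (hasDerivAt_const t (g : Matrix (Fin 2) (Fin 2) ℝ)).deriv
  have h2 : ∀ t, speed (fun _ => g) t = 0 := fun t => by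
    rw [speed, h1, Pi.zero_apply, zero_mul, norm_zero]
  simpa [curveLength, h2] using h

lemma groupDist_mul_right_le (g h k : SL(2, ℝ)) : groupDist (g * k) (h * k) ≤ groupDist g h := by
  refine le_of_forall_gt fun r hr => ?_
  obtain ⟨γ, h1, rfl, rfl, h2⟩ := exists_curve hr
  refine (groupDist_le (h1.mul (IsC1Curve.const k))).trans_lt ?_
  simpa only [curveLength, speed_mul_right γ h1 k] using h2

lemma groupDist_mul_right (g h k : SL(2, ℝ)) : groupDist (g * k) (h * k) = groupDist g h :=
  le_antisymm (groupDist_mul_right_le g h k) <| by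
    simpa using groupDist_mul_right_le (g * k) (h * k) k⁻¹

lemma groupDist_comm_le (g h : SL(2, ℝ)) : groupDist g h ≤ groupDist h g := by
  refine le_of_forall_gt fun r hr => ?_
  obtain ⟨γ, h1, rfl, rfl, h2⟩ := exists_curve hr
  have h3 : IsC1Curve fun t => γ (1 - t) := h1.comp (contDiff_const.sub contDiff_id)
  have h4 : curveLength (fun t => γ (1 - t)) = curveLength γ := by
    have : ∀ t, speed (fun s => γ (1 - s)) t = speed γ (1 - t) := fun t => by
      rw [speed_comp h1 ((hasDerivAt_id' t).const_sub 1)]; simp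
    simp only [curveLength, this]
    rw [intervalIntegral.integral_comp_sub_left (fun t => speed γ t) 1]; simp
  have h5 := groupDist_le h3
  rw [h4] at h5
  simpa using h5.trans_lt h2

lemma groupDist_comm (g h : SL(2, ℝ)) : groupDist g h = groupDist h g :=
  le_antisymm (groupDist_comm_le g h) (groupDist_comm_le h g)

lemma integral_reparam {γ : ℝ → SL(2, ℝ)} (h : IsC1Curve γ) {φ : ℝ → ℝ} (hφ : ContDiff ℝ 1 φ)
    (hm : Monotone φ) (a b : ℝ) :
    ∫ t in a..b, speed (fun s => γ (φ s)) t = ∫ t in φ a..φ b, speed γ t := by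
  have hd : ∀ t, HasDerivAt φ (deriv φ t) t := fun t =>
    (hφ.differentiable one_ne_zero t).hasDerivAt
  have h1 : ∀ t, speed (fun s => γ (φ s)) t = (speed γ ∘ φ) t * deriv φ t := fun t => by
    rw [speed_comp h (hd t), abs_of_nonneg hm.deriv_nonneg, mul_comm]; rfl
  simp only [h1]
  exact intervalIntegral.integral_comp_mul_deriv (fun t _ => hd t)
    (hφ.continuous_deriv le_rfl).continuousOn h.continuous_speed

lemma groupDist_triangle (g h k : SL(2, ℝ)) :
    groupDist g k ≤ groupDist g h + groupDist h k := by
  refine ENNReal.le_of_forall_pos_le_add fun ε hε hfin => ?_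
  have hf1 : groupDist g h ≠ ∞ := fun h0 => by simp [h0] at hfin
  have hf2 : groupDist h k ≠ ∞ := fun h0 => by simp [h0] at hfin
  have hε2 : ((ε / 2 : ℝ≥0) : ℝ≥0∞) ≠ 0 := by simpa using hε.ne'
  obtain ⟨γ, g1, rfl, rfl, g2⟩ := exists_curve (ENNReal.lt_add_right hf1 hε2)
  obtain ⟨η, e1, e0, rfl, e2⟩ := exists_curve (ENNReal.lt_add_right hf2 hε2)
  -- Slow both curves down at their ends, and run through one after the other.
  set φ : ℝ → ℝ := fun t => Real.smoothTransition (2 * t) with hφ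
  set ψ : ℝ → ℝ := fun t => Real.smoothTransition (2 * t - 1) with hψ
  have cφ : ContDiff ℝ 1 φ := Real.smoothTransition.contDiff.comp (contDiff_const.mul contDiff_id)
  have cψ : ContDiff ℝ 1 ψ :=
    Real.smoothTransition.contDiff.comp ((contDiff_const.mul contDiff_id).sub contDiff_const)
  have mφ : Monotone φ := fun s t hst => Real.smoothTransition.monotone (by linarith)
  have mψ : Monotone ψ := fun s t hst => Real.smoothTransition.monotone (by linarith)
  set ζ : ℝ → SL(2, ℝ) := fun t => γ (φ t) * (γ 1)⁻¹ * η (ψ t) with hζ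
  have cζ : IsC1Curve ζ := ((g1.comp cφ).mul (IsC1Curve.const _)).mul (e1.comp cψ)
  have z1 : ∀ t, t ≤ 1 / 2 → ζ t = γ (φ t) := fun t ht => by
    have : ψ t = 0 := Real.smoothTransition.zero_of_nonpos (by linarith)
    simp [hζ, this, e0]
  have z2 : ∀ t, 1 / 2 ≤ t → ζ t = η (ψ t) := fun t ht => by
    have : φ t = 1 := Real.smoothTransition.one_of_one_le (by linarith)
    simp [hζ, this]
  have φ0 : φ 0 = 0 := by simp [hφ]
  have φ1 : φ (1 / 2) = 1 := by simp [hφ]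
  have ψ0 : ψ (1 / 2) = 0 := by simp [hψ]
  have ψ1 : ψ 1 = 1 := by
    simp only [hψ]; norm_num
  have s1 : ∫ t in (0 : ℝ)..(1 / 2), speed ζ t = curveLength γ := by
    have : Set.EqOn (speed ζ) (speed fun s => γ (φ s)) (Set.uIoo 0 (1 / 2)) := fun t ht => by
      rw [Set.uIoo_of_le (by norm_num)] at ht
      exact speed_congr (Filter.mem_of_superset (Iio_mem_nhds ht.2) fun s hs => z1 s (le_of_lt hs))
    rw [intervalIntegral.integral_congr_uIoo this, integral_reparam g1 cφ mφ, φ0, φ1, curveLength]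
  have s2 : ∫ t in (1 / 2 : ℝ)..1, speed ζ t = curveLength η := by
    have : Set.EqOn (speed ζ) (speed fun s => η (ψ s)) (Set.uIoo (1 / 2) 1) := fun t ht => by
      rw [Set.uIoo_of_le (by norm_num)] at ht
      exact speed_congr (Filter.mem_of_superset (Ioi_mem_nhds ht.1) fun s hs => z2 s (le_of_lt hs))
    rw [intervalIntegral.integral_congr_uIoo this, integral_reparam e1 cψ mψ, ψ0, ψ1, curveLength]
  have s3 : curveLength ζ = curveLength γ + curveLength η := by
    rw [← s1, ← s2, curveLength]
    exact (intervalIntegral.integral_add_adjacent_intervals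
      (cζ.continuous_speed.intervalIntegrable _ _)
      (cζ.continuous_speed.intervalIntegrable _ _)).symm
  have h0 : ζ 0 = γ 0 := by rw [z1 0 (by norm_num), φ0]
  have h1 : ζ 1 = η 1 := by rw [z2 1 (by norm_num), ψ1]
  have := groupDist_le cζ
  rw [h0, h1, s3, ENNReal.ofReal_add (curveLength_nonneg _) (curveLength_nonneg _)] at this
  refine this.trans ((add_le_add g2.le e2.le).trans (le_of_eq ?_))
  have h2 : (ε : ℝ≥0∞) = ((ε / 2 : ℝ≥0) : ℝ≥0∞) + ((ε / 2 : ℝ≥0) : ℝ≥0∞) := by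
    rw [← ENNReal.coe_add, add_halves]
  rw [h2]; ring

/-- Short curves do not move the identity far in the matrix norm. -/
lemma norm_sub_one_le {γ : ℝ → SL(2, ℝ)} (h : IsC1Curve γ) (h0 : γ 0 = 1) {r : ℝ}
    (hr : curveLength γ < r) :
    ‖((γ 1).1 : Matrix (Fin 2) (Fin 2) ℝ) - 1‖ ≤
      (‖(1 : Matrix (Fin 2) (Fin 2) ℝ)‖ + 1) * (Real.exp r - 1) := by
  set c : ℝ := ‖(1 : Matrix (Fin 2) (Fin 2) ℝ)‖ + 1 with hc
  have hc0 : 0 < c := by positivity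
  set δ : ℝ := r - curveLength γ with hδ
  set L : ℝ → ℝ := fun t => (∫ s in (0 : ℝ)..t, speed γ s) + δ * t with hL
  have hL' : ∀ t, HasDerivAt L (speed γ t + δ) t := fun t => by
    refine HasDerivAt.add (intervalIntegral.integral_hasDerivAt_right
      (h.continuous_speed.intervalIntegrable _ _)
      (h.continuous_speed.stronglyMeasurableAtFilter _ _) h.continuous_speed.continuousAt) ?_
    simpa using (hasDerivAt_id t).const_mul δ
  have hB : ∀ t, HasDerivAt (fun t => c * (Real.exp (L t) - 1))
      (c * (Real.exp (L t) * (speed γ t + δ))) t := fun t =>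
    (((hL' t).exp).sub_const 1).const_mul c
  have key := image_norm_le_of_norm_deriv_right_lt_deriv_boundary
    (f := fun t => ((γ t).1 : Matrix (Fin 2) (Fin 2) ℝ) - 1) (a := 0) (b := 1)
    (f' := fun t => deriv (fun s => (γ s : Matrix (Fin 2) (Fin 2) ℝ)) t)
    (((ContDiff.continuous h).sub continuous_const).continuousOn)
    (fun t _ => ((h.hasDerivAt t).sub_const 1).hasDerivWithinAt)
    (B := fun t => c * (Real.exp (L t) - 1))
    (by simp [hL, h0]) hB
    (fun t _ ht => by
      have e1 : deriv (fun s => (γ s : Matrix (Fin 2) (Fin 2) ℝ)) t =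
          (deriv (fun s => (γ s : Matrix (Fin 2) (Fin 2) ℝ)) t * ((γ t)⁻¹ : SL(2, ℝ)).1) *
            (γ t).1 := by
        rw [mul_assoc, ← Matrix.SpecialLinearGroup.coe_mul]; simp
      have e2 : ‖deriv (fun s => (γ s : Matrix (Fin 2) (Fin 2) ℝ)) t‖ ≤
          speed γ t * ‖((γ t).1 : Matrix (Fin 2) (Fin 2) ℝ)‖ := by
        conv_lhs => rw [e1]
        exact norm_mul_le _ _
      have e3 : ‖((γ t).1 : Matrix (Fin 2) (Fin 2) ℝ)‖ ≤ c * Real.exp (L t) := by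
        have := norm_add_le (((γ t).1 : Matrix (Fin 2) (Fin 2) ℝ) - 1) 1
        rw [sub_add_cancel, ht] at this
        linarith
      have e4 : 0 < c * Real.exp (L t) := by positivity
      have e5 : 0 < δ := sub_pos.2 hr
      calc _ ≤ speed γ t * (c * Real.exp (L t)) :=
            e2.trans (mul_le_mul_of_nonneg_left e3 (speed_nonneg γ t))
        _ < c * (Real.exp (L t) * (speed γ t + δ)) := by nlinarith)
    (Set.right_mem_Icc.2 zero_le_one)
  have e6 : L 1 = r := by simp [hL, hδ, curveLength]
  simpa only [e6] using key

lemma exists_dist_lt_subset {V : Set SL(2, ℝ)} (hV : V ∈ 𝓝 (1 : SL(2, ℝ))) :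
    ∃ ε : ℝ≥0∞, 0 < ε ∧ ∀ h, groupDist 1 h < ε → h ∈ V := by
  obtain ⟨W, hW, hWV⟩ : ∃ W ∈ 𝓝 (1 : Matrix (Fin 2) (Fin 2) ℝ),
      (fun g : SL(2, ℝ) => g.1) ⁻¹' W ⊆ V := by
    have h : IsInducing fun g : SL(2, ℝ) => g.1 := IsInducing.subtypeVal
    rw [h.nhds_eq_comap] at hV
    exact Filter.mem_comap.1 hV
  obtain ⟨ρ, hρ, hb⟩ := Metric.mem_nhds_iff.1 hW
  set c : ℝ := ‖(1 : Matrix (Fin 2) (Fin 2) ℝ)‖ + 1 with hc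
  have ht : Tendsto (fun r : ℝ => c * (Real.exp r - 1)) (𝓝[>] 0) (𝓝 0) := by
    have : Continuous fun r : ℝ => c * (Real.exp r - 1) := by fun_prop
    simpa using (this.tendsto 0).mono_left nhdsWithin_le_nhds
  obtain ⟨r, hr1, hr0⟩ := ((ht.eventually (gt_mem_nhds hρ)).and self_mem_nhdsWithin).exists
  refine ⟨ENNReal.ofReal r, ENNReal.ofReal_pos.2 hr0, fun h hh => hWV (hb ?_)⟩
  obtain ⟨γ, h1, h2, rfl, h3⟩ := exists_curve hh
  have := norm_sub_one_le h1 h2 ((ENNReal.ofReal_lt_ofReal_iff hr0).1 h3)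
  rw [Metric.mem_ball, dist_eq_norm]
  exact this.trans_lt hr1

/-- The upper triangular unipotent matrix `u_t`; the horocycle flow on `SL(2, ℝ) ⧸ Γ` is
`(t, x) ↦ u t • x`. -/
def u (t : ℝ) : SL(2, ℝ) := ⟨!![1, t; 0, 1], by simp [Matrix.det_fin_two]⟩

/-- The lower triangular unipotent matrices. -/
def lowerUnipotent (t : ℝ) : SL(2, ℝ) := ⟨!![1, 0; t, 1], by simp [Matrix.det_fin_two]⟩

/-- The diagonal matrices with positive entries. -/
noncomputable def diagExp (t : ℝ) : SL(2, ℝ) :=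
  ⟨!![Real.exp t, 0; 0, Real.exp (-t)], by simp [Matrix.det_fin_two, ← Real.exp_add]⟩

/-- A one-parameter group moves the identity by at most a constant times the time. -/
lemma groupDist_oneParam {v : ℝ → SL(2, ℝ)} {X : Matrix (Fin 2) (Fin 2) ℝ}
    (hv : ∀ t, HasDerivAt (fun s => (v s : Matrix (Fin 2) (Fin 2) ℝ)) (X * (v t).1) t)
    (h0 : v 0 = 1) (t : ℝ) : groupDist 1 (v t) ≤ ENNReal.ofReal (|t| * ‖X‖) := by
  have hd : deriv (fun s => (v s : Matrix (Fin 2) (Fin 2) ℝ)) = fun t => X * (v t).1 :=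
    funext fun t => (hv t).deriv
  have hdiff : Differentiable ℝ fun s => (v s : Matrix (Fin 2) (Fin 2) ℝ) :=
    fun t => (hv t).differentiableAt
  have hc : Continuous fun t => X * (v t).1 := continuous_const.mul hdiff.continuous
  have hC : IsC1Curve v := contDiff_one_iff_deriv.2
    ⟨hdiff, hd ▸ hc⟩
  have hs : ∀ s, speed v s = ‖X‖ := fun s => by
    rw [speed, hd]
    simp only [mul_assoc]
    rw [← Matrix.SpecialLinearGroup.coe_mul]
    simp
  have hφ : ∀ s, HasDerivAt (fun s => t * s) t s := fun s => by
    simpa using (hasDerivAt_id s).const_mul t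
  have h1 := groupDist_le (hC.comp (φ := fun s => t * s) (contDiff_const.mul contDiff_id))
  have h2 : curveLength (fun s => v (t * s)) = |t| * ‖X‖ := by
    simp [curveLength, speed_comp hC (hφ _), hs]
  rw [h2] at h1
  simpa [h0] using h1

lemma hasDerivAt_matrix {A : ℝ → Matrix (Fin 2) (Fin 2) ℝ} {B : Matrix (Fin 2) (Fin 2) ℝ} {t : ℝ}
    (h : ∀ i j, HasDerivAt (fun s => A s i j) (B i j) t) : HasDerivAt A B t := by
  have e : ∀ M : Matrix (Fin 2) (Fin 2) ℝ,
      M = ∑ i, ∑ j, M i j • Matrix.single i j (1 : ℝ) := fun M => by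
    conv_lhs => rw [Matrix.matrix_eq_sum_single M]
    simp
  rw [funext fun s => e (A s), e B]
  exact HasDerivAt.fun_sum fun i _ => HasDerivAt.fun_sum fun j _ => (h i j).smul_const _

lemma tendsto_groupDist_of_oneParam {v : ℝ → SL(2, ℝ)} {X : Matrix (Fin 2) (Fin 2) ℝ}
    (hv : ∀ t, HasDerivAt (fun s => (v s : Matrix (Fin 2) (Fin 2) ℝ)) (X * (v t).1) t)
    (h0 : v 0 = 1) : Tendsto (fun t => groupDist 1 (v t)) (𝓝 0) (𝓝 0) := by
  have h1 : Tendsto (fun t : ℝ => ENNReal.ofReal (|t| * ‖X‖)) (𝓝 0) (𝓝 0) := by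
    have : Continuous fun t : ℝ => ENNReal.ofReal (|t| * ‖X‖) :=
      ENNReal.continuous_ofReal.comp (by fun_prop)
    simpa using this.tendsto 0
  exact tendsto_of_tendsto_of_tendsto_of_le_of_le tendsto_const_nhds h1 (fun _ => zero_le)
    fun t => groupDist_oneParam hv h0 t

lemma tendsto_groupDist_one : Tendsto (groupDist 1) (𝓝 (1 : SL(2, ℝ))) (𝓝 0) := by
  have hu : Tendsto (fun t => groupDist 1 (u t)) (𝓝 0) (𝓝 0) :=
    tendsto_groupDist_of_oneParam (X := !![0, 1; 0, 0])
      (fun t => hasDerivAt_matrix fun i j => by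
        fin_cases i <;> fin_cases j <;> simp [u, hasDerivAt_const, hasDerivAt_id'])
      (by ext i j; fin_cases i <;> fin_cases j <;> simp [u])
  have hl : Tendsto (fun t => groupDist 1 (lowerUnipotent t)) (𝓝 0) (𝓝 0) :=
    tendsto_groupDist_of_oneParam (X := !![0, 0; 1, 0])
      (fun t => hasDerivAt_matrix fun i j => by
        fin_cases i <;> fin_cases j <;> simp [lowerUnipotent, hasDerivAt_const, hasDerivAt_id'])
      (by ext i j; fin_cases i <;> fin_cases j <;> simp [lowerUnipotent])
  have hdg : Tendsto (fun t => groupDist 1 (diagExp t)) (𝓝 0) (𝓝 0) :=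
    tendsto_groupDist_of_oneParam (X := !![1, 0; 0, -1])
      (fun t => hasDerivAt_matrix fun i j => by
        fin_cases i <;> fin_cases j <;>
          simp [diagExp, hasDerivAt_const, Real.hasDerivAt_exp]
        simpa using (hasDerivAt_neg t).exp)
      (by ext i j; fin_cases i <;> fin_cases j <;> simp [diagExp])
  have ce : ∀ i j, Continuous fun h : SL(2, ℝ) => h i j := fun i j =>
    (continuous_subtype_val.matrix_elem i j)
  have p : ∀ᶠ h : SL(2, ℝ) in 𝓝 1, 0 < h 0 0 :=
    ((ce 0 0).tendsto 1).eventually (lt_mem_nhds (by simp))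
  have t1 : Tendsto (fun h : SL(2, ℝ) => h 1 0 / h 0 0) (𝓝 1) (𝓝 0) := by
    simpa [Pi.div_def] using ((ce 1 0).tendsto 1).div ((ce 0 0).tendsto 1) (by simp)
  have t2 : Tendsto (fun h : SL(2, ℝ) => h 0 1 / h 0 0) (𝓝 1) (𝓝 0) := by
    simpa [Pi.div_def] using ((ce 0 1).tendsto 1).div ((ce 0 0).tendsto 1) (by simp)
  have t3 : Tendsto (fun h : SL(2, ℝ) => Real.log (h 0 0)) (𝓝 1) (𝓝 0) := by
    simpa using ((ce 0 0).tendsto 1).log (by simp)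
  have t4 : Tendsto (fun h : SL(2, ℝ) => groupDist 1 (u (h 0 1 / h 0 0)) +
      groupDist 1 (diagExp (Real.log (h 0 0))) +
      groupDist 1 (lowerUnipotent (h 1 0 / h 0 0))) (𝓝 1) (𝓝 0) := by
    simpa using ((hu.comp t2).add (hdg.comp t3)).add (hl.comp t1)
  refine tendsto_of_tendsto_of_tendsto_of_le_of_le' tendsto_const_nhds t4
    (Eventually.of_forall fun _ => zero_le) (p.mono fun h hh => ?_)
  have e : h = lowerUnipotent (h 1 0 / h 0 0) * (diagExp (Real.log (h 0 0)) *
      u (h 0 1 / h 0 0)) := by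
    have hdet := h.det_coe
    rw [Matrix.det_fin_two] at hdet
    have e1 : (h.1 : Matrix (Fin 2) (Fin 2) ℝ) = !![1, 0; h 1 0 / h 0 0, 1] *
        (!![h 0 0, 0; 0, (h 0 0)⁻¹] * !![1, h 0 1 / h 0 0; 0, 1]) := by
      have hh' := hh.ne'
      ext i j
      fin_cases i <;> fin_cases j <;> simp [Matrix.mul_apply, Fin.sum_univ_two] <;> field_simp
      linarith
    apply Subtype.ext
    simp only [lowerUnipotent, diagExp, u, Real.exp_neg,
      Real.exp_log hh]
    exact e1
  have gd : ∀ a b : SL(2, ℝ), groupDist 1 (a * b) ≤ groupDist 1 b + groupDist 1 a := fun a b => by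
    refine (groupDist_triangle 1 b (a * b)).trans (add_le_add le_rfl ?_)
    simpa using groupDist_mul_right_le 1 a b
  conv_lhs => rw [e]
  exact (gd _ _).trans (add_le_add (gd _ _) le_rfl)

end Metric

/-! ### The metric space `SL(2, ℝ) ⧸ Γ` -/

section Quotient

variable (Γ : Subgroup SL(2, ℝ))

lemma exists_reps {Γ : Subgroup SL(2, ℝ)} {x y : SL(2, ℝ) ⧸ Γ} {r : ℝ≥0∞}
    (h : quotDist Γ x y < r) (g : SL(2, ℝ)) (hg : (g : SL(2, ℝ) ⧸ Γ) = x) :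
    ∃ k : SL(2, ℝ), (k : SL(2, ℝ) ⧸ Γ) = y ∧ groupDist g k < r := by
  simp only [quotDist, iInf_lt_iff, exists_prop] at h
  obtain ⟨a, b, ha, hb, hab⟩ := h
  have hm : a⁻¹ * g ∈ Γ := QuotientGroup.eq.1 (ha.trans hg.symm)
  refine ⟨b * (a⁻¹ * g), ?_, ?_⟩
  · rw [← hb]; exact QuotientGroup.mk_mul_of_mem b hm
  · have := groupDist_mul_right a b (a⁻¹ * g)
    rw [mul_inv_cancel_left] at this
    rwa [this]

lemma quotDist_mk_le (g h : SL(2, ℝ)) :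
    quotDist Γ (g : SL(2, ℝ) ⧸ Γ) (h : SL(2, ℝ) ⧸ Γ) ≤ groupDist g h :=
  iInf_le_of_le g <| iInf_le_of_le h <| iInf_le_of_le rfl <| iInf_le_of_le rfl le_rfl

lemma quotDist_comm_le (x y : SL(2, ℝ) ⧸ Γ) : quotDist Γ x y ≤ quotDist Γ y x := by
  refine le_of_forall_gt fun r hr => ?_
  obtain ⟨g, rfl⟩ := QuotientGroup.mk_surjective y
  obtain ⟨k, rfl, hk⟩ := exists_reps hr g rfl
  rw [groupDist_comm] at hk
  exact (quotDist_mk_le Γ k g).trans_lt hk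

lemma quotDist_triangle (x y z : SL(2, ℝ) ⧸ Γ) :
    quotDist Γ x z ≤ quotDist Γ x y + quotDist Γ y z := by
  refine ENNReal.le_of_forall_pos_le_add fun ε hε hfin => ?_
  have hf1 : quotDist Γ x y ≠ ∞ := fun h0 => by simp [h0] at hfin
  have hf2 : quotDist Γ y z ≠ ∞ := fun h0 => by simp [h0] at hfin
  have hε2 : ((ε / 2 : ℝ≥0) : ℝ≥0∞) ≠ 0 := by simpa using hε.ne'
  obtain ⟨g, rfl⟩ := QuotientGroup.mk_surjective x
  obtain ⟨k, rfl, hk⟩ := exists_reps (ENNReal.lt_add_right hf1 hε2) g rfl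
  obtain ⟨l, rfl, hl⟩ := exists_reps (ENNReal.lt_add_right hf2 hε2) k rfl
  refine (quotDist_mk_le Γ g l).trans ((groupDist_triangle g k l).trans
    ((add_le_add hk.le hl.le).trans (le_of_eq ?_)))
  have h2 : (ε : ℝ≥0∞) = ((ε / 2 : ℝ≥0) : ℝ≥0∞) + ((ε / 2 : ℝ≥0) : ℝ≥0∞) := by
    rw [← ENNReal.coe_add, add_halves]
  rw [h2]; ring

/-- The quotient distance as an extended pseudometric. -/
noncomputable abbrev quotPseudo : PseudoEMetricSpace (SL(2, ℝ) ⧸ Γ) where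
  edist := quotDist Γ
  edist_self x := by
    obtain ⟨g, rfl⟩ := QuotientGroup.mk_surjective x
    exact le_antisymm ((quotDist_mk_le Γ g g).trans_eq (groupDist_self g)) zero_le
  edist_comm x y := le_antisymm (quotDist_comm_le Γ x y) (quotDist_comm_le Γ y x)
  edist_triangle := quotDist_triangle Γ

/-- The quotient distance induces the quotient topology. -/
lemma topology_eq : (QuotientGroup.instTopologicalSpace Γ : TopologicalSpace (SL(2, ℝ) ⧸ Γ)) =
    (quotPseudo Γ).toUniformSpace.toTopologicalSpace := by
  refine TopologicalSpace.ext_nhds fun x => ?_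
  obtain ⟨g, rfl⟩ := QuotientGroup.mk_surjective x
  refine le_antisymm ?_ ?_
  · rw [(@Metric.nhds_basis_eball _ (quotPseudo Γ) (g : SL(2, ℝ) ⧸ Γ)).ge_iff]
    intro ε hε
    rw [QuotientGroup.nhds_eq, Filter.mem_map]
    have h1 : Tendsto (fun k : SL(2, ℝ) => groupDist 1 (k * g⁻¹)) (𝓝 g) (𝓝 0) := by
      refine tendsto_groupDist_one.comp ?_
      have : Continuous fun k : SL(2, ℝ) => k * g⁻¹ := by fun_prop
      simpa using this.tendsto g
    filter_upwards [h1.eventually (gt_mem_nhds hε)] with k hk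
    have h2 : groupDist k g < ε := by
      have := groupDist_mul_right 1 (k * g⁻¹) g
      rw [one_mul, inv_mul_cancel_right] at this
      rwa [groupDist_comm, this]
    exact (quotDist_mk_le Γ k g).trans_lt h2
  · intro U hU
    rw [QuotientGroup.nhds_eq, Filter.mem_map] at hU
    have h1 : (fun k : SL(2, ℝ) => k * g) ⁻¹' (QuotientGroup.mk ⁻¹' U) ∈ 𝓝 (1 : SL(2, ℝ)) := by
      have : Continuous fun k : SL(2, ℝ) => k * g := by fun_prop
      exact (this.tendsto' 1 g (one_mul g)) hU
    obtain ⟨ε, hε, h2⟩ := exists_dist_lt_subset h1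
    refine (@Metric.nhds_basis_eball _ (quotPseudo Γ) (g : SL(2, ℝ) ⧸ Γ)).mem_iff.2
      ⟨ε, hε, fun y hy => ?_⟩
    have hy' : quotDist Γ (g : SL(2, ℝ) ⧸ Γ) y < ε := (quotDist_comm_le Γ _ _).trans_lt hy
    obtain ⟨k, rfl, hk⟩ := exists_reps hy' g rfl
    have h3 : groupDist 1 (k * g⁻¹) < ε := by
      have := groupDist_mul_right g k g⁻¹
      rw [mul_inv_cancel] at this
      rwa [this]
    simpa using h2 _ h3

/-- `SL(2, ℝ) ⧸ Γ` with the quotient distance (and the quotient topology). -/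
noncomputable instance : PseudoEMetricSpace (SL(2, ℝ) ⧸ Γ) :=
  letI : UniformSpace (SL(2, ℝ) ⧸ Γ) := (quotPseudo Γ).toUniformSpace.replaceTopology
    (topology_eq Γ)
  (quotPseudo Γ).replaceUniformity rfl

/-- For a discrete subgroup `Γ` the quotient distance separates points. -/
noncomputable instance [DiscreteTopology Γ] : EMetricSpace (SL(2, ℝ) ⧸ Γ) :=
  EMetricSpace.ofT0PseudoEMetricSpace _

/-- The Borel `σ`-algebra of `SL(2, ℝ) ⧸ Γ`. -/
instance : MeasurableSpace (SL(2, ℝ) ⧸ Γ) := borel _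

instance : BorelSpace (SL(2, ℝ) ⧸ Γ) := ⟨rfl⟩

/-- A lattice in `SL(2, ℝ)`: a discrete subgroup `Γ` such that `SL(2, ℝ) ⧸ Γ` carries an
`SL(2, ℝ)`-invariant Borel probability measure (which is then unique). -/
class IsLattice : Prop where
  discrete : DiscreteTopology Γ
  exists_invariant : ∃ μ : Measure (SL(2, ℝ) ⧸ Γ), IsProbabilityMeasure μ ∧
    SMulInvariantMeasure SL(2, ℝ) (SL(2, ℝ) ⧸ Γ) μ

instance [h : IsLattice Γ] : DiscreteTopology Γ := h.discrete

end Quotient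

/-! ### Polynomial mixing and polynomial growth -/

/-- `(X, T)` is polynomially mixing for `f` with rate `α`: `|⟪T ^ n f, f⟫| ≤ C n ^ (-α)` for all
`n ≥ 1`, where `⟪f, g⟫ = ∫ f conj(g) dμ`. -/
def PolynomiallyMixing {X : Type*} [MeasurableSpace X] (μ : Measure X) (T : X → X) (f : X → ℂ)
    (α : ℝ) : Prop :=
  0 < α ∧ ∃ C : ℝ, ∀ n : ℕ, 1 ≤ n → ‖∫ x, f (T^[n] x) * conj (f x) ∂μ‖ ≤ C * (n : ℝ) ^ (-α)

/-- `a 1 < a 2 < …` is an increasing sequence of natural numbers that grows polynomially with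
rate `d`. (The value `a 0` plays no role.) -/
def GrowsPolynomially (a : ℕ → ℕ) (d : ℕ) : Prop :=
  StrictMonoOn a (Set.Ici 1) ∧ ∃ C : ℝ, 0 < C ∧ ∀ n : ℕ, 1 ≤ n → (a n : ℝ) ≤ C * (n : ℝ) ^ d

end Horocycle

/-! The proof is a quantitative Borel–Cantelli argument at a scale dictated by the expansion of the
flow. Put `β = min α (1/2)`. For a strictly increasing integer sequence the gaps satisfy `|a i - a
j| ≥ |i - j|`, so polynomial mixing bounds the second moment of the sum of the first `N` terms by a
constant times `N ^ (2 - β)`. By Chebyshev, the points where this sum exceeds `δ N` have measure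
`O(N ^ (-β))` (`exists_measure_lt_norm_sum_le`).

Conjugation by `u t` expands a neighbourhood of the identity by at most a multiple of `1 + t ^ 2`.
Up to time `a N = O(N ^ d)`, a displacement of size `r ≈ N ^ (-2d)` therefore changes the average of
the Lipschitz function `f` only slightly. Hence the bad set for one threshold, thickened by `r`,
stays in the bad set for a smaller threshold, and it is covered by `O(N ^ (-β) r ^ (-3))` cubes of
side `r`. The corresponding `s`-dimensional cost is of order `N ^ (2d(3 - s) - β)`. For `s = 3 - β /
(4d)` this is `N ^ (-β / 2)`, which is summable along the times `N = j ^ m` with `m` large; these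
times suffice because averages of bounded sequences vary slowly (`frequently_average_pow`).
`hausdorffMeasure_frequently_eq_zero` turns summability into vanishing Hausdorff measure.

The covering takes place in a chart made of three matrix entries. There Lebesgue measure is
dominated by the invariant measure (`exists_volume_le_mul_measure`), and the chart map to the
quotient is Lipschitz, so dimension bounds descend to the quotient. -/

namespace Horocycle

/-! ### Hausdorff measure of a limsup set of thickened sets -/

section Hausdorff

open Measure

variable {ι : Type*}

/-- The cells of the grid of side `r` in `ι → ℝ`. -/
def gridCell (r : ℝ) (z : ι → ℤ) : Set (ι → ℝ) := (fun p i => ⌊p i / r⌋) ⁻¹' {z}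

lemma gridCell_eq_pi {r : ℝ} (hr : 0 < r) (z : ι → ℤ) :
    gridCell r z = Set.univ.pi fun i => Set.Ico (z i * r) (z i * r + r) := by
  ext p
  simp only [gridCell, Set.mem_preimage, Set.mem_singleton_iff, Set.mem_univ_pi, Set.mem_Ico,
    funext_iff, Int.floor_eq_iff, le_div_iff₀ hr, div_lt_iff₀ hr, add_mul, one_mul]

lemma dist_le_of_mem_gridCell [Fintype ι] {r : ℝ} (hr : 0 < r) {z : ι → ℤ} {p q : ι → ℝ}
    (hp : p ∈ gridCell r z) (hq : q ∈ gridCell r z) : dist p q ≤ r := by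
  rw [gridCell_eq_pi hr, Set.mem_univ_pi] at hp hq
  refine (dist_pi_le_iff hr.le).2 fun i => ?_
  have h1 := hp i
  have h2 := hq i
  rw [Set.mem_Ico] at h1 h2
  rw [Real.dist_eq, abs_le]
  constructor <;> linarith

lemma volume_gridCell [Fintype ι] {r : ℝ} (hr : 0 < r) (z : ι → ℤ) :
    volume (gridCell r z) = ENNReal.ofReal (r ^ Fintype.card ι) := by
  rw [gridCell_eq_pi hr, Real.volume_pi_Ico]
  simp [ENNReal.ofReal_pow hr.le]

lemma measurableSet_gridCell [Fintype ι] {r : ℝ} (hr : 0 < r) (z : ι → ℤ) :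
    MeasurableSet (gridCell r z) := by
  rw [gridCell_eq_pi hr]
  exact MeasurableSet.univ_pi fun i => measurableSet_Ico

/-- If the `r j`-neighbourhood of `A j` lies in `B j`, and the `B j` are small enough in measure,
then the limsup of the `A j` has vanishing `s`-dimensional Hausdorff measure. -/
theorem hausdorffMeasure_frequently_eq_zero [Fintype ι] {s : ℝ} (hs : 0 < s) {r : ℕ → ℝ}
    (hr : ∀ j, 0 < r j) (hr' : Antitone r) (hr0 : Tendsto r atTop (𝓝 0)) {A B : ℕ → Set (ι → ℝ)}
    (hAB : ∀ j, ∀ p ∈ A j, ∀ q, dist p q ≤ r j → q ∈ B j)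
    (hsum : ∑' j, ENNReal.ofReal (r j ^ (s - Fintype.card ι)) * volume (B j) ≠ ∞) :
    μH[s] {p | ∃ᶠ j in atTop, p ∈ A j} = 0 := by
  classical
  -- The `n`-th cover uses all levels from `n` on. Cells missing `A` become empty, which keeps the
  -- index type fixed and costs nothing because `s > 0`.
  set t : ℕ → ℕ × (ι → ℤ) → Set (ι → ℝ) := fun n x =>
    if (gridCell (r (x.1 + n)) x.2 ∩ A (x.1 + n)).Nonempty then gridCell (r (x.1 + n)) x.2 else ∅
    with ht
  have hdiam : ∀ n x, Metric.ediam (t n x) ≤ ENNReal.ofReal (r (x.1 + n)) := fun n x => by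
    simp only [ht]
    split_ifs with h
    · refine Metric.ediam_le fun p hp q hq => ?_
      rw [edist_dist]
      exact ENNReal.ofReal_le_ofReal (dist_le_of_mem_gridCell (hr _) hp hq)
    · simp
  have hsub : ∀ n, {p | ∃ᶠ j in atTop, p ∈ A j} ⊆ ⋃ x, t n x := fun n p hp => by
    obtain ⟨j, hj, hpj⟩ := (frequently_atTop.1 hp) n
    obtain ⟨k, rfl⟩ := Nat.exists_eq_add_of_le' hj
    have hp' : p ∈ gridCell (r (k + n)) (fun i => ⌊p i / r (k + n)⌋) := rfl
    refine Set.mem_iUnion.2 ⟨(k, fun i => ⌊p i / r (k + n)⌋), ?_⟩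
    simp only [ht]
    rw [if_pos ⟨p, hp', hpj⟩]
    exact hp'
  set g : ℕ → ℝ≥0∞ := fun j => ENNReal.ofReal (r j ^ (s - Fintype.card ι)) * volume (B j) with hg
  have hlevel : ∀ n j, ∑' z, Metric.ediam (t n (j, z)) ^ s ≤ g (j + n) := fun n j => by
    -- For a cell of side `r`, `r ^ s` is `r ^ (s - card ι)` times its volume, so counting cells
    -- becomes measuring their disjoint union, which lies in `B`.
    have h1 : ∀ z, Metric.ediam (t n (j, z)) ^ s ≤
        ENNReal.ofReal (r (j + n) ^ (s - Fintype.card ι)) * volume (t n (j, z)) := fun z => by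
      by_cases h : (gridCell (r (j + n)) z ∩ A (j + n)).Nonempty
      · have e : t n (j, z) = gridCell (r (j + n)) z := if_pos h
        refine (ENNReal.rpow_le_rpow (hdiam n (j, z)) hs.le).trans (le_of_eq ?_)
        rw [e, volume_gridCell (hr _), ← ENNReal.ofReal_mul (Real.rpow_nonneg (hr _).le _),
          ENNReal.ofReal_rpow_of_pos (hr _), ← Real.rpow_natCast, ← Real.rpow_add (hr _),
          sub_add_cancel]
      · have e : t n (j, z) = ∅ := if_neg h
        simp [e, hs]
    refine (ENNReal.tsum_le_tsum h1).trans ?_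
    rw [ENNReal.tsum_mul_left]
    refine mul_le_mul_right ?_ _
    rw [← measure_iUnion]
    · refine measure_mono (Set.iUnion_subset fun z => ?_)
      simp only [ht]
      split_ifs with h
      · obtain ⟨p, hp, hpA⟩ := h
        exact fun q hq => hAB _ p hpA q (dist_le_of_mem_gridCell (hr _) hp hq)
      · exact Set.empty_subset _
    · intro z z' hz
      refine Disjoint.mono (b := gridCell (r (j + n)) z) (d := gridCell (r (j + n)) z') ?_ ?_
        ((Set.disjoint_singleton.2 hz).preimage _) <;>
      · simp only [ht]
        split_ifs <;> simp
    · intro z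
      simp only [ht]
      split_ifs
      · exact measurableSet_gridCell (hr _) _
      · exact MeasurableSet.empty
  -- The cost of the `n`-th cover is at most the `n`-th tail of a convergent series.
  have htend : Tendsto (fun n => ∑' x, Metric.ediam (t n x) ^ s) atTop (𝓝 0) := by
    refine tendsto_of_tendsto_of_tendsto_of_le_of_le tendsto_const_nhds
      (ENNReal.tendsto_sum_nat_add g hsum) (fun _ => zero_le) fun n => ?_
    simp only [ENNReal.tsum_prod']
    exact ENNReal.tsum_le_tsum (hlevel n)
  have hR : Tendsto (fun n => ENNReal.ofReal (r n)) atTop (𝓝 0) := by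
    simpa using ENNReal.tendsto_ofReal hr0
  have := hausdorffMeasure_le_liminf_tsum s {p | ∃ᶠ j in atTop, p ∈ A j} _ hR t
    (Eventually.of_forall fun n x => (hdiam n x).trans
      (ENNReal.ofReal_le_ofReal (hr' (Nat.le_add_left _ _)))) (Eventually.of_forall hsub)
  rw [htend.liminf_eq] at this
  exact le_antisymm this zero_le

end Hausdorff

/-! ### Averages along polynomial subsequences -/

/-- Averages of bounded sequences vary slowly: largeness along all times implies largeness
along the times `j ^ m`. -/
lemma frequently_average_pow {E : Type*} [NormedAddCommGroup E] {v : ℕ → E} {M ε δ : ℝ}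
    (hM : ∀ n, ‖v n‖ ≤ M) (hδ0 : 0 ≤ δ) (hδ : δ < ε) {m : ℕ} (hm : m ≠ 0)
    (h : ∃ᶠ N : ℕ in atTop, ε * N < ‖∑ n ∈ Finset.Icc 1 N, v n‖) :
    ∃ᶠ j : ℕ in atTop, δ * (j ^ m : ℕ) < ‖∑ n ∈ Finset.Icc 1 (j ^ m), v n‖ := by
  have hM0 : 0 ≤ M := (norm_nonneg _).trans (hM 0)
  -- Consecutive times `j ^ m` and `(j + 1) ^ m` have ratio tending to `1`, so the terms between
  -- them contribute a negligible proportion.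
  have hlim : Tendsto (fun j : ℕ => M * ((1 + 1 / (j : ℝ)) ^ m - 1)) atTop (𝓝 0) := by
    have := ((tendsto_one_div_atTop_nhds_zero_nat (𝕜 := ℝ)).const_add 1).pow m
    simpa using (this.sub_const 1).const_mul M
  obtain ⟨J, hJ⟩ := eventually_atTop.1
    ((hlim.eventually (gt_mem_nhds (sub_pos.2 hδ))).and (eventually_gt_atTop 0))
  refine frequently_atTop.2 fun K => ?_
  obtain ⟨N, hN, hlt⟩ := (frequently_atTop.1 h) ((max J K) ^ m)
  obtain ⟨j, hj1, hj2⟩ : ∃ j, j ^ m ≤ N ∧ N < (j + 1) ^ m := by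
    have hex : ∃ k, N < (k + 1) ^ m := ⟨N, (Nat.lt_succ_self N).trans_le (Nat.le_self_pow hm _)⟩
    classical
    refine ⟨Nat.find hex, ?_, Nat.find_spec hex⟩
    rcases Nat.eq_zero_or_pos (Nat.find hex) with h0 | h0
    · simp [h0, hm]
    · have := Nat.find_min hex (Nat.sub_lt h0 one_pos)
      rwa [Nat.sub_add_cancel (m := 1) h0, not_lt] at this
  have hjm : max J K ≤ j := Nat.lt_succ_iff.1 (lt_of_pow_lt_pow_left' m (hN.trans_lt hj2))
  refine ⟨j, (le_max_right _ _).trans hjm, ?_⟩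
  obtain ⟨hj3, hj0⟩ := hJ j ((le_max_left _ _).trans hjm)
  have hj0' : (0 : ℝ) < j := Nat.cast_pos.2 hj0
  have hsplit : ∑ n ∈ Finset.Icc 1 N, v n =
      ∑ n ∈ Finset.Icc 1 (j ^ m), v n + ∑ n ∈ Finset.Ioc (j ^ m) N, v n := by
    have hI : ∀ k, Finset.Icc 1 k = Finset.Ioc 0 k := fun k => rfl
    rw [hI, hI, Finset.sum_Ioc_consecutive v (Nat.zero_le _) hj1]
  have htail : ‖∑ n ∈ Finset.Ioc (j ^ m) N, v n‖ ≤ M * (N - (j ^ m : ℕ)) := by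
    refine (norm_sum_le_of_le _ fun n _ => hM n).trans (le_of_eq ?_)
    rw [Finset.sum_const, Nat.card_Ioc, nsmul_eq_mul, Nat.cast_sub hj1, mul_comm]
  have h1 : ‖∑ n ∈ Finset.Icc 1 N, v n‖ ≤
      ‖∑ n ∈ Finset.Icc 1 (j ^ m), v n‖ + M * (N - (j ^ m : ℕ)) := by
    rw [hsplit]; exact (norm_add_le _ _).trans (by gcongr)
  have h2 : M * ((N : ℝ) - (j ^ m : ℕ)) ≤ (ε - δ) * (j ^ m : ℕ) := by
    have e : (1 + 1 / (j : ℝ)) ^ m * (j : ℝ) ^ m = ((j + 1 : ℕ) : ℝ) ^ m := by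
      rw [← mul_pow]; congr 1; push_cast; field_simp
    have hN' : (N : ℝ) ≤ ((j + 1 : ℕ) : ℝ) ^ m := by exact_mod_cast hj2.le
    calc M * ((N : ℝ) - (j ^ m : ℕ)) ≤ M * (((j + 1 : ℕ) : ℝ) ^ m - (j : ℝ) ^ m) := by
          push_cast at hN' ⊢; gcongr
      _ = M * ((1 + 1 / (j : ℝ)) ^ m - 1) * (j : ℝ) ^ m := by rw [← e]; ring
      _ ≤ (ε - δ) * (j ^ m : ℕ) := by push_cast; gcongr
  have h3 : ε * (j ^ m : ℕ) ≤ ε * N := by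
    have : ((j ^ m : ℕ) : ℝ) ≤ N := by exact_mod_cast hj1
    exact mul_le_mul_of_nonneg_left this (hδ0.trans hδ.le)
  linarith

/-! ### Sums of negative powers of index distances. -/

lemma sum_rpow_neg_le {β : ℝ} (h0 : 0 ≤ β) (h1 : β < 1) (N : ℕ) :
    ∑ k ∈ Finset.range N, ((k : ℝ) + 1) ^ (-β) ≤ (N : ℝ) ^ (1 - β) / (1 - β) := by
  induction N with
  | zero => simp; positivity
  | succ N ih =>
    rw [Finset.sum_range_succ]
    have hN : (0 : ℝ) < N + 1 := by positivity
    -- Bernoulli's inequality for the exponent `1 - β` in `[0, 1]`: the new term is at most the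
    -- increment of `N ^ (1 - β) / (1 - β)`.
    have hb := rpow_one_add_le_one_add_mul_self (s := -1 / (N + 1 : ℝ))
      (by rw [neg_div, neg_le_neg_iff, div_le_one hN]; linarith [Nat.cast_nonneg (α := ℝ) N])
      (p := 1 - β) (by linarith) (by linarith)
    have e1 : 1 + -1 / (N + 1 : ℝ) = N / (N + 1) := by field_simp; ring
    rw [e1, Real.div_rpow (by positivity) hN.le, div_le_iff₀ (by positivity)] at hb
    have e2 : ((N : ℝ) + 1) ^ (-β) = ((N : ℝ) + 1) ^ (1 - β) / (N + 1) := by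
      rw [show -β = (1 - β) - 1 by ring, Real.rpow_sub_one hN.ne']
    push_cast
    rw [e2]
    have h2 : 0 < 1 - β := by linarith
    have h3 : ((N : ℝ) + 1) ^ (1 - β) / (N + 1) ≤
      (((N : ℝ) + 1) ^ (1 - β) - (N : ℝ) ^ (1 - β)) / (1 - β) := by
      rw [le_div_iff₀ h2]
      have : (1 + (1 - β) * (-1 / (N + 1 : ℝ))) * ((N : ℝ) + 1) ^ (1 - β) =
        ((N : ℝ) + 1) ^ (1 - β) - ((N : ℝ) + 1) ^ (1 - β) / (N + 1) * (1 - β) := by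
        field_simp; ring
      linarith
    rw [sub_div] at h3
    linarith

/-- The sum of a power of the distances to `i` over an initial segment. -/
lemma sum_dist_rpow_le {β : ℝ} (h0 : 0 ≤ β) (h1 : β < 1) {N i : ℕ} (hi : i ∈ Finset.Icc 1 N) :
    ∑ j ∈ Finset.Icc 1 N, (Nat.dist i j + 1 : ℝ) ^ (-β) ≤ 2 / (1 - β) * (N : ℝ) ^ (1 - β) := by
  obtain ⟨hi1, hi2⟩ := Finset.mem_Icc.1 hi
  have hI : ∀ k, Finset.Icc 1 k = Finset.Ico 1 (k + 1) := fun k => rfl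
  have hmono : ∀ K ≤ N, ∑ k ∈ Finset.range K, ((k : ℝ) + 1) ^ (-β) ≤
      (N : ℝ) ^ (1 - β) / (1 - β) := fun K hK => (sum_rpow_neg_le h0 h1 K).trans (by
    have : (K : ℝ) ≤ N := by exact_mod_cast hK
    have h2 : 0 < 1 - β := by linarith
    gcongr)
  -- Cut after `j = i`: each side is dominated by the one-sided sum, the left one after reflection.
  -- This gives the factor `2`.
  rw [hI, ← Finset.sum_Ico_consecutive _ (Nat.le_add_left 1 i) (Nat.add_le_add_right hi2 1),
    Finset.sum_Ico_eq_sum_range, Finset.sum_Ico_eq_sum_range]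
  have a1 : ∑ k ∈ Finset.range (i + 1 - 1), (Nat.dist i (1 + k) + 1 : ℝ) ^ (-β) ≤
      (N : ℝ) ^ (1 - β) / (1 - β) := by
    refine le_trans (le_of_eq ?_) (hmono i hi2)
    rw [Nat.add_sub_cancel, ← Finset.sum_range_reflect]
    refine Finset.sum_congr rfl fun k hk => ?_
    have : Nat.dist i (1 + (i - 1 - k)) = k := by
      have := Finset.mem_range.1 hk
      rw [Nat.dist_eq_sub_of_le_right (by omega)]; omega
    rw [this]
  have a2 : ∑ k ∈ Finset.range (N + 1 - (i + 1)), (Nat.dist i (i + 1 + k) + 1 : ℝ) ^ (-β) ≤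
      (N : ℝ) ^ (1 - β) / (1 - β) := by
    refine le_trans (Finset.sum_le_sum fun k _ => ?_) (hmono (N + 1 - (i + 1)) (by omega))
    refine Real.rpow_le_rpow_of_nonpos (by positivity) ?_ (by linarith)
    have : k ≤ Nat.dist i (i + 1 + k) := by
      rw [Nat.dist_eq_sub_of_le (by omega)]; omega
    have : (k : ℝ) ≤ Nat.dist i (i + 1 + k) := by exact_mod_cast this
    linarith
  calc _ ≤ (N : ℝ) ^ (1 - β) / (1 - β) + (N : ℝ) ^ (1 - β) / (1 - β) := add_le_add a1 a2
    _ = _ := by ring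

/-! ### Local estimates for the distance on `SL(2, ℝ)` -/

section LocalDistance

attribute [local instance] Matrix.frobeniusNormedAddCommGroup Matrix.frobeniusNormedSpace
  Matrix.frobeniusNormedRing Matrix.frobeniusNormedAlgebra

lemma groupDist_mul_le (a b : SL(2, ℝ)) :
    groupDist 1 (a * b) ≤ groupDist 1 a + groupDist 1 b := by
  refine (groupDist_triangle 1 b (a * b)).trans ?_
  rw [add_comm]
  refine add_le_add ?_ le_rfl
  simpa using groupDist_mul_right_le 1 a b

lemma exists_groupDist_u_le : ∃ C : ℝ, 0 ≤ C ∧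
    ∀ t, groupDist 1 (u t) ≤ ENNReal.ofReal (|t| * C) ∧
      groupDist 1 (lowerUnipotent t) ≤ ENNReal.ofReal (|t| * C) ∧
      groupDist 1 (diagExp t) ≤ ENNReal.ofReal (|t| * C) := by
  have hu := groupDist_oneParam (v := u) (X := !![0, 1; 0, 0])
      (fun t => hasDerivAt_matrix fun i j => by
        fin_cases i <;> fin_cases j <;> simp [u, hasDerivAt_const, hasDerivAt_id'])
      (by ext i j; fin_cases i <;> fin_cases j <;> simp [u])
  have hl := groupDist_oneParam (v := lowerUnipotent) (X := !![0, 0; 1, 0])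
      (fun t => hasDerivAt_matrix fun i j => by
        fin_cases i <;> fin_cases j <;> simp [lowerUnipotent, hasDerivAt_const, hasDerivAt_id'])
      (by ext i j; fin_cases i <;> fin_cases j <;> simp [lowerUnipotent])
  have hdg := groupDist_oneParam (v := diagExp) (X := !![1, 0; 0, -1])
      (fun t => hasDerivAt_matrix fun i j => by
        fin_cases i <;> fin_cases j <;>
          simp [diagExp, hasDerivAt_const, Real.hasDerivAt_exp]
        simpa using (hasDerivAt_neg t).exp)
      (by ext i j; fin_cases i <;> fin_cases j <;> simp [diagExp])
  refine ⟨‖(!![0, 1; 0, 0] : Matrix (Fin 2) (Fin 2) ℝ)‖ +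
    ‖(!![0, 0; 1, 0] : Matrix (Fin 2) (Fin 2) ℝ)‖ +
    ‖(!![1, 0; 0, -1] : Matrix (Fin 2) (Fin 2) ℝ)‖, by positivity, fun t =>
    ⟨(hu t).trans ?_, (hl t).trans ?_, (hdg t).trans ?_⟩⟩ <;>
  · refine ENNReal.ofReal_le_ofReal (mul_le_mul_of_nonneg_left ?_ (abs_nonneg t))
    linarith [norm_nonneg (!![0, 1; 0, 0] : Matrix (Fin 2) (Fin 2) ℝ),
      norm_nonneg (!![0, 0; 1, 0] : Matrix (Fin 2) (Fin 2) ℝ),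
      norm_nonneg (!![1, 0; 0, -1] : Matrix (Fin 2) (Fin 2) ℝ)]

end LocalDistance

/-- Gauss decomposition. Each factor lies in a one-parameter group, where the distance to the
identity is at most linear in the parameter. -/
lemma eq_lower_mul_diag_mul_upper {h : SL(2, ℝ)} (hh : 0 < h 0 0) :
    h = lowerUnipotent (h 1 0 / h 0 0) * (diagExp (Real.log (h 0 0)) *
      u (h 0 1 / h 0 0)) := by
  have hdet := h.det_coe
  rw [Matrix.det_fin_two] at hdet
  have e1 : (h.1 : Matrix (Fin 2) (Fin 2) ℝ) = !![1, 0; h 1 0 / h 0 0, 1] *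
      (!![h 0 0, 0; 0, (h 0 0)⁻¹] * !![1, h 0 1 / h 0 0; 0, 1]) := by
    have hh' := hh.ne'
    ext i j
    fin_cases i <;> fin_cases j <;> simp [Matrix.mul_apply, Fin.sum_univ_two] <;> field_simp
    linarith
  apply Subtype.ext
  simp only [lowerUnipotent, diagExp, u, Real.exp_neg, Real.exp_log hh]
  exact e1

lemma abs_log_le {x δ : ℝ} (hδ : δ ≤ 1 / 2) (h : |x - 1| ≤ δ) : |Real.log x| ≤ 2 * δ := by
  obtain ⟨h1, h2⟩ := abs_le.1 h
  have hx : 1 / 2 ≤ x := by linarith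
  have hx0 : 0 < x := by linarith
  rw [abs_le]
  constructor
  · have := Real.one_sub_inv_le_log_of_pos hx0
    have h3 : x⁻¹ ≤ 1 + 2 * δ := by
      rw [inv_le_iff_one_le_mul₀ hx0]
      nlinarith
    linarith
  · have := Real.log_le_sub_one_of_pos hx0
    linarith [(abs_nonneg (x - 1)).trans h]

/-- Near the identity the Riemannian distance is controlled by the matrix entries. -/
lemma exists_groupDist_one_le : ∃ C : ℝ, 0 ≤ C ∧ ∀ (h : SL(2, ℝ)) (δ : ℝ), δ ≤ 1 / 2 →
    |h 0 0 - 1| ≤ δ → |h 0 1| ≤ δ → |h 1 0| ≤ δ → groupDist 1 h ≤ ENNReal.ofReal (C * δ) := by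
  obtain ⟨C, hC, hb⟩ := exists_groupDist_u_le
  -- Each of the three Gauss factors has parameter at most `2 * δ`.
  refine ⟨6 * C, by positivity, fun h δ hδ h00 h01 h10 => ?_⟩
  have hδ0 : 0 ≤ δ := (abs_nonneg _).trans h01
  have hh : 1 / 2 ≤ h 0 0 := by linarith [(abs_le.1 h00).1]
  have hh0 : 0 < h 0 0 := by linarith
  have hq : ∀ x : ℝ, |x| ≤ δ → |x / h 0 0| ≤ 2 * δ := fun x hx => by
    rw [abs_div, abs_of_pos hh0, div_le_iff₀ hh0]
    nlinarith
  have hlog := abs_log_le hδ h00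
  rw [eq_lower_mul_diag_mul_upper hh0]
  refine (groupDist_mul_le _ _).trans ((add_le_add (hb _).2.1 ((groupDist_mul_le _ _).trans
    (add_le_add (hb _).2.2 (hb _).1))).trans ?_)
  rw [← ENNReal.ofReal_add (by positivity) (by positivity),
    ← ENNReal.ofReal_add (by positivity) (by positivity)]
  refine ENNReal.ofReal_le_ofReal ?_
  nlinarith [hq _ h01, hq _ h10]

/-! ### A chart of `SL(2, ℝ)` at the identity -/

/-- The inverse chart: three matrix entries determine the fourth. (The truncation makes it
continuous everywhere.) -/
noncomputable def chartInv (q : Fin 3 → ℝ) : SL(2, ℝ) :=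
  ⟨!![max (1 + q 0) (1 / 2), q 1; q 2, (1 + q 1 * q 2) / max (1 + q 0) (1 / 2)], by
    have : max (1 + q 0) (1 / 2 : ℝ) ≠ 0 := (lt_max_of_lt_right (by norm_num)).ne'
    rw [Matrix.det_fin_two]
    simp only [Matrix.of_apply, Matrix.cons_val', Matrix.cons_val_zero, Matrix.cons_val_one,
      Matrix.cons_val_fin_one]
    field_simp
    ring⟩

/-- The chart: the matrix entries other than the lower right one, centred at the identity. -/
def chart (g : SL(2, ℝ)) : Fin 3 → ℝ := ![g 0 0 - 1, g 0 1, g 1 0]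

lemma abs_apply_le {q : Fin 3 → ℝ} {ρ : ℝ} (hq : q ∈ Metric.closedBall 0 ρ) (i : Fin 3) :
    |q i| ≤ ρ := by
  rw [mem_closedBall_zero_iff] at hq
  exact (norm_le_pi_norm q i).trans hq

lemma mem_closedBall_fin_three {q : Fin 3 → ℝ} {ρ : ℝ} :
    q ∈ Metric.closedBall 0 ρ ↔ |q 0| ≤ ρ ∧ |q 1| ≤ ρ ∧ |q 2| ≤ ρ := by
  refine ⟨fun h => ⟨abs_apply_le h 0, abs_apply_le h 1, abs_apply_le h 2⟩, fun ⟨h0, h1, h2⟩ => ?_⟩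
  rw [mem_closedBall_zero_iff, pi_norm_le_iff_of_nonneg ((abs_nonneg _).trans h0)]
  intro i
  fin_cases i <;> assumption

lemma chartInv_entries {q : Fin 3 → ℝ} (hq : q ∈ Metric.closedBall 0 (1 / 2)) :
    chartInv q 0 0 = 1 + q 0 ∧ chartInv q 0 1 = q 1 ∧ chartInv q 1 0 = q 2 ∧
      chartInv q 1 1 = (1 + q 1 * q 2) / (1 + q 0) := by
  have h : max (1 + q 0) (1 / 2) = 1 + q 0 :=
    max_eq_left (by linarith [(abs_le.1 (abs_apply_le hq 0)).1])
  exact ⟨h, rfl, rfl, congrArg (fun m => (1 + q 1 * q 2) / m) h⟩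

lemma continuous_chartInv : Continuous chartInv := by
  refine continuous_induced_rng.2 (continuous_matrix fun i j => ?_)
  have hm : Continuous fun q : Fin 3 → ℝ => max (1 + q 0) (1 / 2) := by fun_prop
  have h0 : ∀ q : Fin 3 → ℝ, max (1 + q 0) (1 / 2 : ℝ) ≠ 0 := fun q =>
    (lt_max_of_lt_right (by norm_num)).ne'
  fin_cases i <;> fin_cases j
  · exact hm
  · exact continuous_apply 1
  · exact continuous_apply 2
  · exact Continuous.div (by fun_prop) hm h0

lemma chart_chartInv {q : Fin 3 → ℝ} (hq : q ∈ Metric.closedBall 0 (1 / 2)) :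
    chart (chartInv q) = q := by
  obtain ⟨h0, h1, h2, -⟩ := chartInv_entries hq
  funext i
  fin_cases i <;> simp [chart, h0, h1, h2]

lemma chartInv_chart {g : SL(2, ℝ)} (hg : |g 0 0 - 1| ≤ 1 / 2) : chartInv (chart g) = g := by
  have hdet := g.det_coe
  rw [Matrix.det_fin_two] at hdet
  have h1 : 1 / 2 ≤ g 0 0 := by linarith [(abs_le.1 hg).1]
  have h2 : g 0 0 ≠ 0 := by linarith
  have h3 : max (1 + (g 0 0 - 1)) (1 / 2) = g 0 0 := by rw [add_sub_cancel]; exact max_eq_left h1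
  apply Subtype.ext
  ext i j
  fin_cases i <;> fin_cases j
  · exact h3
  · rfl
  · rfl
  · change (1 + g 0 1 * g 1 0) / max (1 + (g 0 0 - 1)) (1 / 2) = g 1 1
    rw [h3, div_eq_iff h2]
    linarith

lemma continuous_chart : Continuous chart := by
  have ce : ∀ i j, Continuous fun h : SL(2, ℝ) => h i j := fun i j =>
    continuous_subtype_val.matrix_elem i j
  refine continuous_pi fun i => ?_
  fin_cases i
  · exact (ce 0 0).sub continuous_const
  · exact ce 0 1
  · exact ce 1 0

lemma abs_mul_le_mul {x y a b : ℝ} (hx : |x| ≤ a) (hy : |y| ≤ b) : |x * y| ≤ a * b := by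
  rw [abs_mul]
  exact mul_le_mul hx hy (abs_nonneg _) ((abs_nonneg _).trans hx)

lemma abs_chartInv_le {q : Fin 3 → ℝ} (hq : q ∈ Metric.closedBall 0 (1 / 2)) :
    |chartInv q 0 0| ≤ 3 / 2 ∧ |chartInv q 0 1| ≤ 1 / 2 ∧ |chartInv q 1 0| ≤ 1 / 2 ∧
      |chartInv q 1 1| ≤ 5 / 2 := by
  obtain ⟨e0, e1, e2, e3⟩ := chartInv_entries hq
  obtain ⟨h0, h1, h2⟩ := mem_closedBall_fin_three.1 hq
  rw [e0, e1, e2, e3]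
  have h12 := abs_le.1 (abs_mul_le_mul h1 h2)
  have h0' := abs_le.1 h0
  refine ⟨abs_le.2 ⟨by linarith, by linarith⟩, h1, h2, ?_⟩
  have hp : 0 < 1 + q 0 := by linarith
  rw [abs_div, abs_of_pos hp, div_le_iff₀ hp, abs_le]
  constructor <;> nlinarith

lemma abs_chartInv_sub_le {p q : Fin 3 → ℝ} (hp : p ∈ Metric.closedBall 0 (1 / 2))
    (hq : q ∈ Metric.closedBall 0 (1 / 2)) (i j : Fin 2) :
    |chartInv p i j - chartInv q i j| ≤ 7 * dist p q := by
  obtain ⟨a0, a1, a2, a3⟩ := chartInv_entries hp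
  obtain ⟨e0, e1, e2, e3⟩ := chartInv_entries hq
  have hd : ∀ k, |p k - q k| ≤ dist p q := fun k => by
    rw [← Real.dist_eq]; exact dist_le_pi_dist p q k
  have hd0 : 0 ≤ dist p q := dist_nonneg
  fin_cases i <;> fin_cases j
  · simp only [Fin.zero_eta, a0, e0, add_sub_add_left_eq_sub]
    linarith [hd 0]
  · simp only [Fin.zero_eta, Fin.mk_one, a1, e1]
    linarith [hd 1]
  · simp only [Fin.zero_eta, Fin.mk_one, a2, e2]
    linarith [hd 2]
  · simp only [Fin.mk_one, a3, e3]
    obtain ⟨h0, h1, h2⟩ := mem_closedBall_fin_three.1 hp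
    obtain ⟨k0, k1, k2⟩ := mem_closedBall_fin_three.1 hq
    have hp0 : 1 / 2 ≤ 1 + p 0 := by linarith [(abs_le.1 h0).1]
    have hq0 : 1 / 2 ≤ 1 + q 0 := by linarith [(abs_le.1 k0).1]
    have b1 := abs_mul_le_mul h1 (hd 2)
    have b2 := abs_mul_le_mul k2 (hd 1)
    -- The numerators are at most `δ` and `5 / 2 * δ` with `δ = dist p q`, and the denominator is at
    -- least `1 / 2`: this is the source of the constant `7`.
    have e : (1 + p 1 * p 2) / (1 + p 0) - (1 + q 1 * q 2) / (1 + q 0) =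
        (p 1 * (p 2 - q 2) + q 2 * (p 1 - q 1)) / (1 + p 0) -
          (1 + q 1 * q 2) / (1 + q 0) * (p 0 - q 0) / (1 + p 0) := by
      have : 1 + p 0 ≠ 0 := by linarith
      have : 1 + q 0 ≠ 0 := by linarith
      field_simp
      ring
    have b3 := abs_mul_le_mul (abs_chartInv_le hq).2.2.2 (hd 0)
    rw [e3] at b3
    rw [e, ← sub_div, abs_div, abs_of_pos (by linarith : 0 < 1 + p 0), div_le_iff₀ (by linarith)]
    refine (abs_sub _ _).trans ((add_le_add_left (abs_add_le _ _) _).trans ?_)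
    nlinarith

/-! ### Matrix entries and the quadratic expansion of the horocycle flow. -/

lemma inv_entries (g : SL(2, ℝ)) : g⁻¹ 0 0 = g 1 1 ∧ g⁻¹ 0 1 = - g 0 1 ∧
    g⁻¹ 1 0 = - g 1 0 ∧ g⁻¹ 1 1 = g 0 0 := by
  simp [Matrix.SpecialLinearGroup.SL2_inv_expl]

lemma mul_entries (g h : SL(2, ℝ)) (i j : Fin 2) :
    (g * h) i j = g i 0 * h 0 j + g i 1 * h 1 j := by
  simp [Matrix.SpecialLinearGroup.coe_mul, Matrix.mul_apply, Fin.sum_univ_two]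

lemma u_entries (t : ℝ) : u t 0 0 = 1 ∧ u t 0 1 = t ∧ u t 1 0 = 0 ∧ u t 1 1 = 1 := by
  simp [u]

lemma u_add (s t : ℝ) : u (s + t) = u s * u t := by
  ext i j
  rw [mul_entries]
  fin_cases i <;> fin_cases j <;> simp [u, add_comm]

lemma u_zero : u 0 = 1 := by
  ext i j
  fin_cases i <;> fin_cases j <;> simp [u]

lemma u_neg (t : ℝ) : u (-t) = (u t)⁻¹ :=
  eq_inv_of_mul_eq_one_left (by rw [← u_add, neg_add_cancel, u_zero])

/-- Conjugation by `u t` expands the distance to the identity at most quadratically in `t`. -/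
lemma abs_conj_u_le {h : SL(2, ℝ)} {η : ℝ} (h00 : |h 0 0 - 1| ≤ η) (h01 : |h 0 1| ≤ η)
    (h10 : |h 1 0| ≤ η) (h11 : |h 1 1 - 1| ≤ η) (t : ℝ) :
    |(u t * h * u (-t)) 0 0 - 1| ≤ 2 * (1 + t ^ 2) * η ∧
      |(u t * h * u (-t)) 0 1| ≤ 2 * (1 + t ^ 2) * η ∧
      |(u t * h * u (-t)) 1 0| ≤ 2 * (1 + t ^ 2) * η := by
  have hη : 0 ≤ η := (abs_nonneg _).trans h01
  -- The worst entry of the conjugate is `h 0 1 + t * (h 1 1 - h 0 0) - t ^ 2 * h 1 0`, of size at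
  -- most `(1 + 2 * |t| + t ^ 2) * η`.
  have ht : 2 * |t| ≤ 1 + t ^ 2 := by
    rw [← sq_abs t]; nlinarith [sq_nonneg (|t| - 1)]
  have b1 := abs_mul_le_mul (le_refl |t|) h10
  have b2 := abs_mul_le_mul (le_refl |t|) h00
  have b3 := abs_mul_le_mul (le_refl |t|) h11
  have b4 := abs_mul_le_mul (le_of_eq (abs_of_nonneg (sq_nonneg t))) h10
  have ht' := mul_le_mul_of_nonneg_right ht hη
  have ht2 := mul_nonneg (sq_nonneg t) hη
  obtain ⟨u0, u1, u2, u3⟩ := u_entries t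
  obtain ⟨v0, v1, v2, v3⟩ := u_entries (-t)
  simp only [mul_entries, u0, u1, u2, u3, v0, v1, v2, v3]
  simp only [abs_le] at *
  refine ⟨⟨?_, ?_⟩, ⟨?_, ?_⟩, ?_, ?_⟩ <;> linarith

/-- By right invariance the distance of the two translates is at most that of the identity to the
conjugate by `u t` of `chartInv q * (chartInv p)⁻¹`, to which `abs_conj_u_le` applies. The constants
do not depend on `Γ` or on the base point. -/
lemma exists_edist_u_smul_chartInv_le : ∃ C c : ℝ, 0 ≤ C ∧ 0 < c ∧
    ∀ (Γ : Subgroup SL(2, ℝ)) (x : SL(2, ℝ) ⧸ Γ) (t : ℝ), ∀ p ∈ Metric.closedBall 0 (1 / 2),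
      ∀ q ∈ Metric.closedBall 0 (1 / 2), (1 + t ^ 2) * dist p q ≤ c →
        edist (u t • chartInv p • x) (u t • chartInv q • x) ≤
          ENNReal.ofReal (C * ((1 + t ^ 2) * dist p q)) := by
  obtain ⟨C, hC, hb⟩ := exists_groupDist_one_le
  -- The quotient matrix is within `21 * dist p q` of the identity, where `21 = 7 * (5 / 2 + 1 /
  -- 2)`, and conjugation doubles this up to the factor `1 + t ^ 2`. The bound `1 / 84` keeps the
  -- result below `1 / 2`.
  refine ⟨42 * C, 1 / 84, by positivity, by norm_num, fun Γ x t p hp q hq hpq => ?_⟩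
  obtain ⟨k, rfl⟩ := QuotientGroup.mk_surjective x
  have e1 : edist (u t • chartInv p • (k : SL(2, ℝ) ⧸ Γ)) (u t • chartInv q • (k : SL(2, ℝ) ⧸ Γ)) ≤
      groupDist (u t * (chartInv p * k)) (u t * (chartInv q * k)) := quotDist_mk_le Γ _ _
  have e2 : groupDist (u t * (chartInv p * k)) (u t * (chartInv q * k)) =
      groupDist 1 (u t * (chartInv q * (chartInv p)⁻¹) * u (-t)) := by
    rw [← groupDist_mul_right 1 _ (u t * (chartInv p * k)), u_neg]
    congr 1 <;> group
  refine e1.trans (e2.trans_le ?_)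
  set δ := dist p q with hδ
  have hδ0 : 0 ≤ δ := dist_nonneg
  have hd := abs_chartInv_sub_le hq hp
  rw [dist_comm q p, ← hδ] at hd
  obtain ⟨k0, k1, k2, k3⟩ := abs_chartInv_le hp
  obtain ⟨i0, i1, i2, i3⟩ := inv_entries (chartInv p)
  have hdet := (chartInv p).det_coe
  rw [Matrix.det_fin_two] at hdet
  have c0 : ∀ i, |(chartInv q i 0 - chartInv p i 0) * chartInv p 1 1 -
      (chartInv q i 1 - chartInv p i 1) * chartInv p 1 0| ≤ 21 * δ := fun i =>
    (abs_sub _ _).trans (by linarith [abs_mul_le_mul (hd i 0) k3, abs_mul_le_mul (hd i 1) k2])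
  have c1 : ∀ i, |(chartInv q i 1 - chartInv p i 1) * chartInv p 0 0 -
      (chartInv q i 0 - chartInv p i 0) * chartInv p 0 1| ≤ 21 * δ := fun i =>
    (abs_sub _ _).trans (by linarith [abs_mul_le_mul (hd i 0) k1, abs_mul_le_mul (hd i 1) k0])
  obtain ⟨f0, f1, f2⟩ := abs_conj_u_le (h := chartInv q * (chartInv p)⁻¹) (η := 21 * δ)
    (by rw [mul_entries, i0, i2]; convert c0 0 using 2; linarith)
    (by rw [mul_entries, i1, i3]; convert c1 0 using 2; ring)
    (by rw [mul_entries, i0, i2]; convert c0 1 using 2; ring)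
    (by rw [mul_entries, i1, i3]; convert c1 1 using 2; linarith) t
  refine (hb _ (2 * (1 + t ^ 2) * (21 * δ)) (by linarith) f0 f1 f2).trans
    (ENNReal.ofReal_le_ofReal (by linarith))

/-! ### Comparison of Lebesgue measure in the chart with an invariant measure -/

lemma lipschitzOnWith_chart_mul {h : SL(2, ℝ)} (hh : ∀ i j, |h i j| ≤ 2) :
    LipschitzOnWith 28 (fun q => chart (chartInv q * h)) (Metric.closedBall 0 (1 / 2)) := by
  refine LipschitzOnWith.of_dist_le_mul fun p hp q hq => ?_
  have hd := abs_chartInv_sub_le hp hq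
  have hm : ∀ i j, |(chartInv p * h) i j - (chartInv q * h) i j| ≤ 28 * dist p q := fun i j => by
    have e : (chartInv p * h) i j - (chartInv q * h) i j =
        (chartInv p i 0 - chartInv q i 0) * h 0 j + (chartInv p i 1 - chartInv q i 1) * h 1 j := by
      rw [mul_entries, mul_entries]; ring
    rw [e]
    exact (abs_add_le _ _).trans (by
      linarith [abs_mul_le_mul (hd i 0) (hh 0 j), abs_mul_le_mul (hd i 1) (hh 1 j)])
  refine (dist_pi_le_iff (by positivity)).2 fun i => ?_
  rw [Real.dist_eq]
  fin_cases i
  · simpa [chart] using hm 0 0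
  · simpa [chart] using hm 0 1
  · simpa [chart] using hm 1 0

/-- The open neighbourhood of the identity given by the small chart cube. -/
def smallNhd : Set SL(2, ℝ) := chart ⁻¹' Metric.ball 0 (1 / 10)

lemma isOpen_smallNhd : IsOpen smallNhd := Metric.isOpen_ball.preimage continuous_chart

lemma one_mem_smallNhd : (1 : SL(2, ℝ)) ∈ smallNhd := by
  have : chart 1 = 0 := by
    funext i
    fin_cases i <;> simp [chart]
  simp [smallNhd, this]

lemma abs_sub_le_of_chart_mem {g : SL(2, ℝ)} (hg : chart g ∈ Metric.closedBall 0 (1 / 10)) :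
    |g 0 0 - 1| ≤ 1 / 10 ∧ |g 0 1| ≤ 1 / 10 ∧ |g 1 0| ≤ 1 / 10 ∧ |g 1 1 - 1| ≤ 1 / 8 := by
  obtain ⟨h0, h1, h2⟩ := mem_closedBall_fin_three.1 hg
  refine ⟨h0, h1, h2, ?_⟩
  have hdet := g.det_coe
  rw [Matrix.det_fin_two] at hdet
  have h12 := abs_le.1 (abs_mul_le_mul h1 h2)
  have h0' := abs_le.1 h0
  simp only [chart, Matrix.cons_val_zero, Matrix.cons_val_one, Matrix.cons_val] at h0' h12
  rw [abs_le]
  constructor <;> nlinarith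

/-- Right translation by `h` is `28`-Lipschitz in the chart, so it increases three-dimensional
Hausdorff measure, here Lebesgue measure, at most by the factor `28 ^ 3`. No Jacobian or Haar
density is needed. -/
lemma volume_chart_le_mul_right {h : SL(2, ℝ)} (hh : h ∈ smallNhd) (A : Set SL(2, ℝ)) :
    volume {q | q ∈ Metric.closedBall 0 (1 / 10) ∧ chartInv q ∈ A} ≤
      28 ^ 3 * volume {q | q ∈ Metric.closedBall 0 (1 / 2) ∧ chartInv q * h ∈ A} := by
  obtain ⟨h00, h01, h10, h11⟩ := abs_sub_le_of_chart_mem (Metric.ball_subset_closedBall hh)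
  rw [abs_le] at h00 h01 h10 h11
  have hL := lipschitzOnWith_chart_mul (h := h) (fun i j => by
    fin_cases i <;> fin_cases j <;> refine abs_le.2 ⟨?_, ?_⟩ <;> simp <;> linarith)
  set W := {q | q ∈ Metric.closedBall 0 (1 / 2) ∧ chartInv q * h ∈ A} with hW
  have hsub : {q | q ∈ Metric.closedBall 0 (1 / 10) ∧ chartInv q ∈ A} ⊆
      (fun q => chart (chartInv q * h)) '' W := by
    -- The preimage of `q` is the chart of `chartInv q * h⁻¹`; both factors are so close to the
    -- identity that it stays in the larger cube.
    rintro q ⟨hq, hqA⟩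
    have hq' := Metric.closedBall_subset_closedBall (by norm_num : (1 / 10 : ℝ) ≤ 1 / 2) hq
    obtain ⟨g00, g01, g10, g11⟩ := abs_sub_le_of_chart_mem (g := chartInv q)
      (by rwa [chart_chartInv hq'])
    rw [abs_le] at g00 g01 g10 g11
    obtain ⟨i0, i1, i2, i3⟩ := inv_entries h
    have hT : chart (chartInv q * h⁻¹) ∈ Metric.closedBall 0 (1 / 2) := by
      refine mem_closedBall_fin_three.2 ⟨?_, ?_, ?_⟩ <;>
        simp only [chart, Matrix.cons_val_zero, Matrix.cons_val_one, Matrix.cons_val, mul_entries,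
          i0, i1, i2, i3] <;> refine abs_le.2 ⟨?_, ?_⟩ <;> nlinarith
    have hT' := chartInv_chart (mem_closedBall_fin_three.1 hT).1
    refine ⟨chart (chartInv q * h⁻¹), ⟨hT, ?_⟩, ?_⟩
    · rwa [hT', inv_mul_cancel_right]
    · simp only [hT', inv_mul_cancel_right, chart_chartInv hq']
  refine (measure_mono hsub).trans ?_
  have := (hL.mono (fun q hq => hq.1 : W ⊆ _)).hausdorffMeasure_image_le
    (d := (Fintype.card (Fin 3) : ℝ)) (by positivity)
  rw [hausdorffMeasure_pi_real] at this
  refine this.trans (le_of_eq ?_)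
  congr 1
  simp only [Fintype.card_fin]
  exact_mod_cast rfl

/-! ### Averaging over an invariant measure on the quotient. -/

variable {Γ : Subgroup SL(2, ℝ)}

lemma isOpen_image_smul (x : SL(2, ℝ) ⧸ Γ) {V : Set SL(2, ℝ)} (hV : IsOpen V) :
    IsOpen ((fun g => g • x) '' V) := by
  obtain ⟨k, rfl⟩ := QuotientGroup.mk_surjective x
  have h1 : IsOpen ((fun g => g * k) '' V) := (isOpenMap_mul_right k) V hV
  have h2 := (QuotientGroup.isOpenMap_coe (N := Γ)) _ h1
  rw [Set.image_image] at h2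
  exact h2

instance : SecondCountableTopology SL(2, ℝ) :=
  haveI : SecondCountableTopology (Matrix (Fin 2) (Fin 2) ℝ) :=
    inferInstanceAs (SecondCountableTopology (Fin 2 → Fin 2 → ℝ))
  TopologicalSpace.Subtype.secondCountableTopology _

/-- The action is transitive, so translates of this open set cover the quotient, and countably many
suffice. If one were null, all would be, and `μ` would vanish. -/
lemma measure_image_smul_pos (μ : Measure (SL(2, ℝ) ⧸ Γ)) [NeZero μ]
    [SMulInvariantMeasure SL(2, ℝ) (SL(2, ℝ) ⧸ Γ) μ] (x : SL(2, ℝ) ⧸ Γ) {V : Set SL(2, ℝ)}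
    (hV : IsOpen V) (hne : V.Nonempty) : 0 < μ ((fun g => g • x) '' V) := by
  obtain ⟨v, hv⟩ := hne
  set O := (fun g : SL(2, ℝ) => g • x) '' V with hO
  have hOo : IsOpen O := isOpen_image_smul x hV
  by_contra h0
  have hO0 : μ O = 0 := by simpa using h0
  have hex : ∀ y : SL(2, ℝ) ⧸ Γ, ∃ g : SL(2, ℝ), g • y ∈ O := fun y => by
    obtain ⟨g, hg⟩ := MulAction.exists_smul_eq SL(2, ℝ) y x
    exact ⟨v * g, v, hv, by simp only [mul_smul, hg]⟩
  choose g hg using hex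
  obtain ⟨s, hs, hcov⟩ := TopologicalSpace.countable_cover_nhds
    (f := fun y : SL(2, ℝ) ⧸ Γ => (fun z => g y • z) ⁻¹' O)
    (fun y => (hOo.preimage (continuous_const_smul (g y))).mem_nhds (hg y))
  refine NeZero.ne μ (Measure.measure_univ_eq_zero.1 ?_)
  rw [← hcov]
  refine (measure_biUnion_null_iff hs).2 fun y _ => ?_
  rw [SMulInvariantMeasure.measure_preimage_smul (g y) hOo.measurableSet, hO0]

/-- Integration of the invariance of `μ` over a cube in the chart. -/
lemma lintegral_volume_smul_mem (μ : Measure (SL(2, ℝ) ⧸ Γ)) [IsProbabilityMeasure μ]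
    [SMulInvariantMeasure SL(2, ℝ) (SL(2, ℝ) ⧸ Γ) μ] (ρ : ℝ) {A : Set (SL(2, ℝ) ⧸ Γ)}
    (hA : IsOpen A) :
    ∫⁻ x, volume {q | q ∈ Metric.closedBall 0 ρ ∧ chartInv q • x ∈ A} ∂μ =
      volume (Metric.closedBall (0 : Fin 3 → ℝ) ρ) * μ A := by
  set ν : Measure (Fin 3 → ℝ) := volume.restrict (Metric.closedBall 0 ρ) with hν
  set W : Set ((Fin 3 → ℝ) × (SL(2, ℝ) ⧸ Γ)) := {z | chartInv z.1 • z.2 ∈ A} with hW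
  have hc : Continuous fun z : (Fin 3 → ℝ) × (SL(2, ℝ) ⧸ Γ) => chartInv z.1 • z.2 :=
    (continuous_chartInv.comp continuous_fst).smul continuous_snd
  have hWm : MeasurableSet W := (hA.preimage hc).measurableSet
  -- Compute the product measure of `W` in both orders; by invariance every slice over `q` has
  -- measure `μ A`.
  have h1 := Measure.prod_apply (μ := ν) (ν := μ) hWm
  have h2 := Measure.prod_apply_symm (μ := ν) (ν := μ) hWm
  have e1 : ∀ q, μ (Prod.mk q ⁻¹' W) = μ A := fun q =>
    SMulInvariantMeasure.measure_preimage_smul (chartInv q) hA.measurableSet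
  have e2 : ∀ x, ν ((fun q => (q, x)) ⁻¹' W) =
      volume {q | q ∈ Metric.closedBall 0 ρ ∧ chartInv q • x ∈ A} := fun x => by
    rw [hν, Measure.restrict_apply' measurableSet_closedBall, Set.inter_comm]
    rfl
  simp only [e1, lintegral_const, hν, Measure.restrict_apply_univ] at h1
  simp only [e2] at h2
  rw [← h2, hν, h1, mul_comm]

/-- In the chart at any point, Lebesgue measure is dominated by an invariant measure. -/
theorem exists_volume_le_mul_measure (μ : Measure (SL(2, ℝ) ⧸ Γ)) [IsProbabilityMeasure μ]
    [SMulInvariantMeasure SL(2, ℝ) (SL(2, ℝ) ⧸ Γ) μ] (x : SL(2, ℝ) ⧸ Γ) :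
    ∃ C : ℝ≥0∞, C ≠ ∞ ∧ ∀ A : Set (SL(2, ℝ) ⧸ Γ), IsOpen A →
      volume {q | q ∈ Metric.closedBall 0 (1 / 10) ∧ chartInv q • x ∈ A} ≤ C * μ A := by
  set O := (fun g : SL(2, ℝ) => g • x) '' smallNhd with hO
  have hOpos : 0 < μ O := measure_image_smul_pos μ x isOpen_smallNhd ⟨1, one_mem_smallNhd⟩
  have hOm : MeasurableSet O := (isOpen_image_smul x isOpen_smallNhd).measurableSet
  set v := volume (Metric.closedBall (0 : Fin 3 → ℝ) (1 / 2)) with hv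
  have hvt : v ≠ ∞ := measure_closedBall_lt_top.ne
  refine ⟨28 ^ 3 * v / μ O, ENNReal.div_ne_top (ENNReal.mul_ne_top (by finiteness) hvt) hOpos.ne',
    fun A hA => ?_⟩
  set w := volume {q | q ∈ Metric.closedBall 0 (1 / 10) ∧ chartInv q • x ∈ A} with hw
  have h1 : ∀ y ∈ O, w ≤ 28 ^ 3 *
      volume {q | q ∈ Metric.closedBall 0 (1 / 2) ∧ chartInv q • y ∈ A} := by
    rintro _ ⟨h, hh, rfl⟩
    have := volume_chart_le_mul_right hh {g | g • x ∈ A}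
    simpa only [Set.mem_ofPred_eq, mul_smul] using this
  -- The bound `h1` compares the fixed base point `x` with every nearby `y`. Integrating over `y ∈
  -- O` replaces the volume at `y` by its mean, which is a multiple of `μ A`.
  have h2 : w * μ O ≤ 28 ^ 3 * (v * μ A) := by
    rw [← lintegral_volume_smul_mem μ (1 / 2) hA, ← lintegral_const_mul' _ _ (by finiteness),
      ← setLIntegral_const]
    exact (setLIntegral_mono' hOm h1).trans (setLIntegral_le_lintegral _ _)
  rw [← ENNReal.mul_div_right_comm, ENNReal.le_div_iff_mul_le (Or.inl hOpos.ne')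
    (Or.inl (measure_ne_top _ _))]
  exact h2.trans (le_of_eq (by ring))

/-! ### The second moment of the ergodic sums -/

lemma add_sub_le_of_strictMonoOn {a : ℕ → ℕ} (ha : StrictMonoOn a (Set.Ici 1)) {m n : ℕ}
    (hm : 1 ≤ m) (hmn : m ≤ n) : a m + (n - m) ≤ a n := by
  induction n, hmn using Nat.le_induction with
  | base => simp
  | succ n hmn ih =>
    have := ha (Set.mem_Ici.2 (hm.trans hmn)) (Set.mem_Ici.2 (by omega : 1 ≤ n + 1))
      (Nat.lt_succ_self n)
    omega

lemma iterate_u_one_smul (n : ℕ) (x : SL(2, ℝ) ⧸ Γ) : (fun x => u 1 • x)^[n] x = u n • x := by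
  induction n with
  | zero => simp [u_zero]
  | succ n ih =>
    rw [Function.iterate_succ_apply', ih, smul_smul, ← u_add, Nat.cast_succ, add_comm (1 : ℝ)]

/-- Correlations depend only on time differences, so the self-correlation decay in the mixing
hypothesis controls all cross terms of the ergodic sums. -/
lemma integral_smul_mul_conj_smul (μ : Measure (SL(2, ℝ) ⧸ Γ))
    [SMulInvariantMeasure SL(2, ℝ) (SL(2, ℝ) ⧸ Γ) μ] (f : SL(2, ℝ) ⧸ Γ → ℂ) (s t : ℝ) :
    ∫ x, f (u (s + t) • x) * conj (f (u t • x)) ∂μ = ∫ x, f (u s • x) * conj (f x) ∂μ := by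
  have := integral_smul_eq_self (μ := μ) (fun x => f (u s • x) * conj (f x)) (g := u t)
  simpa only [smul_smul, ← u_add] using this

/-- Decay of correlations along a strictly increasing sequence. -/
lemma exists_norm_integral_mul_conj_le (μ : Measure (SL(2, ℝ) ⧸ Γ)) [IsProbabilityMeasure μ]
    [SMulInvariantMeasure SL(2, ℝ) (SL(2, ℝ) ⧸ Γ) μ] {f : SL(2, ℝ) ⧸ Γ → ℂ} {M α β : ℝ}
    (hM : ∀ x, ‖f x‖ ≤ M) (hmix : PolynomiallyMixing μ (fun x => u 1 • x) f α) (hβ0 : 0 ≤ β)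
    (hβ1 : β ≤ 1) (hβα : β ≤ α) :
    ∃ D : ℝ, 0 ≤ D ∧ ∀ a : ℕ → ℕ, StrictMonoOn a (Set.Ici 1) → ∀ i j, 1 ≤ i → 1 ≤ j →
      ‖∫ x, f (u (a i) • x) * conj (f (u (a j) • x)) ∂μ‖ ≤ D * (Nat.dist i j + 1 : ℝ) ^ (-β) := by
  obtain ⟨-, C, hC⟩ := hmix
  simp only [iterate_u_one_smul] at hC
  have hC0 : 0 ≤ C := by simpa using (norm_nonneg _).trans (hC 1 le_rfl)
  -- `M * M` serves the diagonal. The `2` is the cost of replacing `i - j ≥ 1` by `i - j + 1`, since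
  -- `2 ^ β ≤ 2`.
  refine ⟨M * M + 2 * C, add_nonneg (mul_self_nonneg M) (by positivity), fun a ha => ?_⟩
  have key : ∀ i j, 1 ≤ j → j < i → ‖∫ x, f (u (a i) • x) * conj (f (u (a j) • x)) ∂μ‖ ≤
      (M * M + 2 * C) * (Nat.dist i j + 1 : ℝ) ^ (-β) := fun i j hj hji => by
    have hgap := add_sub_le_of_strictMonoOn ha hj hji.le
    obtain ⟨k, hk⟩ := Nat.exists_eq_add_of_le' (show a j ≤ a i by omega)
    have hk1 : i - j ≤ k := by omega
    have hij : 1 ≤ i - j := by omega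
    rw [hk, Nat.cast_add, integral_smul_mul_conj_smul]
    have hdist : Nat.dist i j = i - j := Nat.dist_eq_sub_of_le_right hji.le
    have hpos : (1 : ℝ) ≤ (i - j : ℕ) := by exact_mod_cast hij
    have h1 : (k : ℝ) ^ (-α) ≤ ((i - j : ℕ) : ℝ) ^ (-β) :=
      (Real.rpow_le_rpow_of_exponent_le (by exact_mod_cast hij.trans hk1) (by linarith)).trans
        (Real.rpow_le_rpow_of_nonpos (by linarith) (by exact_mod_cast hk1) (by linarith))
    have h2 : ((i - j : ℕ) : ℝ) ^ (-β) ≤ 2 * (((i - j : ℕ) : ℝ) + 1) ^ (-β) := by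
      have h3 : (2 * ((i - j : ℕ) : ℝ)) ^ (-β) ≤ (((i - j : ℕ) : ℝ) + 1) ^ (-β) :=
        Real.rpow_le_rpow_of_nonpos (by linarith) (by linarith) (by linarith)
      have h4 : (2 : ℝ) ^ (-1 : ℝ) ≤ 2 ^ (-β) :=
        Real.rpow_le_rpow_of_exponent_le one_le_two (by linarith)
      rw [Real.mul_rpow zero_le_two (by linarith)] at h3
      rw [Real.rpow_neg_one] at h4
      have h5 := mul_le_mul_of_nonneg_right h4
        (Real.rpow_nonneg (by linarith : (0 : ℝ) ≤ (i - j : ℕ)) (-β))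
      linarith
    rw [hdist]
    have h6 : 0 ≤ (((i - j : ℕ) : ℝ) + 1) ^ (-β) := by positivity
    calc _ ≤ C * (k : ℝ) ^ (-α) := hC k (hij.trans hk1)
      _ ≤ C * (2 * (((i - j : ℕ) : ℝ) + 1) ^ (-β)) :=
        mul_le_mul_of_nonneg_left (h1.trans h2) hC0
      _ ≤ _ := by nlinarith [mul_nonneg (mul_self_nonneg M) h6]
  intro i j hi hj
  rcases lt_trichotomy i j with h | rfl | h
  · have e : ∫ x, f (u (a i) • x) * conj (f (u (a j) • x)) ∂μ =
        conj (∫ x, f (u (a j) • x) * conj (f (u (a i) • x)) ∂μ) := by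
      rw [← integral_conj]
      congr 1
      funext x
      simp [mul_comm]
    rw [e, RCLike.norm_conj, Nat.dist_comm]
    exact key j i hi h
  · rw [Nat.dist_self]
    refine (norm_integral_le_of_norm_le_const (C := M * M) (Eventually.of_forall fun x => ?_)).trans
      ?_
    · rw [norm_mul, RCLike.norm_conj]
      exact mul_self_le_mul_self (norm_nonneg _) (hM _)
    · simpa using hC0
  · exact key i j hj h

lemma integral_norm_sq_sum_le {X : Type*} [MeasurableSpace X] {μ : Measure X}
    [IsFiniteMeasure μ] {g : ℕ → X → ℂ} (hg : ∀ i, Measurable (g i)) {M : ℝ}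
    (hM : ∀ i x, ‖g i x‖ ≤ M) (S : Finset ℕ) :
    ∫ x, ‖∑ i ∈ S, g i x‖ ^ 2 ∂μ ≤ ∑ i ∈ S, ∑ j ∈ S, ‖∫ x, g i x * conj (g j x) ∂μ‖ := by
  have hint : ∀ i j, Integrable (fun x => g i x * conj (g j x)) μ := fun i j => by
    refine Integrable.of_bound (C := M * M) (Measurable.aestronglyMeasurable
      ((hg i).mul (Complex.continuous_conj.measurable.comp (hg j))))
      (Eventually.of_forall fun x => ?_)
    rw [norm_mul, RCLike.norm_conj]
    exact mul_le_mul (hM i x) (hM j x) (norm_nonneg _) ((norm_nonneg _).trans (hM i x))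
  have e1 : ((∫ x, ‖∑ i ∈ S, g i x‖ ^ 2 ∂μ : ℝ) : ℂ) =
      ∑ i ∈ S, ∑ j ∈ S, ∫ x, g i x * conj (g j x) ∂μ := by
    rw [← integral_complex_ofReal]
    simp only [← integral_finsetSum _ (fun j _ => hint _ j)]
    rw [← integral_finsetSum _ (fun i _ => integrable_finsetSum _ fun j _ => hint i j)]
    congr 1
    funext x
    rw [Complex.ofReal_pow, ← Complex.mul_conj', map_sum, Finset.sum_mul_sum]
  have h0 : 0 ≤ ∫ x, ‖∑ i ∈ S, g i x‖ ^ 2 ∂μ := integral_nonneg fun x => by positivity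
  calc _ = ‖((∫ x, ‖∑ i ∈ S, g i x‖ ^ 2 ∂μ : ℝ) : ℂ)‖ := by
        rw [Complex.norm_real, Real.norm_of_nonneg h0]
    _ ≤ _ := by
        rw [e1]
        exact norm_sum_le_of_le _ fun i _ => norm_sum_le _ _

/-- The Chebyshev bound for the ergodic sums along a strictly increasing sequence. -/
theorem exists_measure_lt_norm_sum_le (μ : Measure (SL(2, ℝ) ⧸ Γ)) [IsProbabilityMeasure μ]
    [SMulInvariantMeasure SL(2, ℝ) (SL(2, ℝ) ⧸ Γ) μ] {f : SL(2, ℝ) ⧸ Γ → ℂ} {M α β : ℝ}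
    (hf : Continuous f) (hM : ∀ x, ‖f x‖ ≤ M)
    (hmix : PolynomiallyMixing μ (fun x => u 1 • x) f α) (hβ0 : 0 ≤ β)
    (hβ1 : β < 1) (hβα : β ≤ α) {a : ℕ → ℕ} (ha : StrictMonoOn a (Set.Ici 1)) {δ : ℝ}
    (hδ : 0 < δ) :
    ∃ D : ℝ, 0 ≤ D ∧ ∀ N : ℕ, 1 ≤ N →
      μ {x | δ * N < ‖∑ n ∈ Finset.Icc 1 N, f (u (a n) • x)‖} ≤
        ENNReal.ofReal (D * (N : ℝ) ^ (-β)) := by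
  obtain ⟨D, hD, hcorr⟩ := exists_norm_integral_mul_conj_le μ hM hmix hβ0 hβ1.le hβα
  have h1β : 0 < 1 - β := by linarith
  refine ⟨D * (2 / (1 - β)) / δ ^ 2, by positivity, fun N hN => ?_⟩
  have hN0 : (0 : ℝ) < N := by exact_mod_cast hN
  have hgm : ∀ n : ℕ, Continuous fun x : SL(2, ℝ) ⧸ Γ => f (u (a n) • x) := fun n =>
    hf.comp (continuous_const_smul _)
  have h2 : ∫ x, ‖∑ n ∈ Finset.Icc 1 N, f (u (a n) • x)‖ ^ 2 ∂μ ≤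
      D * (2 / (1 - β)) * ((N : ℝ) ^ 2 * (N : ℝ) ^ (-β)) := by
    calc _ ≤ ∑ i ∈ Finset.Icc 1 N, ∑ j ∈ Finset.Icc 1 N,
          ‖∫ x, f (u (a i) • x) * conj (f (u (a j) • x)) ∂μ‖ :=
          integral_norm_sq_sum_le (fun n => (hgm n).measurable) (fun n x => hM _) _
      _ ≤ ∑ i ∈ Finset.Icc 1 N, D * (2 / (1 - β) * (N : ℝ) ^ (1 - β)) := by
          refine Finset.sum_le_sum fun i hi => ?_
          refine (Finset.sum_le_sum fun j hj => hcorr a ha i j (Finset.mem_Icc.1 hi).1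
            (Finset.mem_Icc.1 hj).1).trans ?_
          rw [← Finset.mul_sum]
          exact mul_le_mul_of_nonneg_left (sum_dist_rpow_le hβ0 hβ1 hi) hD
      _ = _ := by
          rw [Finset.sum_const, Nat.card_Icc, Nat.add_sub_cancel, nsmul_eq_mul,
            show (1 : ℝ) - β = 1 + -β by ring, Real.rpow_add hN0, Real.rpow_one]
          ring
  have hcont : Continuous fun x : SL(2, ℝ) ⧸ Γ =>
      ‖∑ n ∈ Finset.Icc 1 N, f (u (a n) • x)‖ ^ 2 :=
    (continuous_finsetSum _ fun n _ => hgm n).norm.pow 2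
  have hint : Integrable (fun x : SL(2, ℝ) ⧸ Γ =>
      ‖∑ n ∈ Finset.Icc 1 N, f (u (a n) • x)‖ ^ 2) μ := by
    refine Integrable.of_bound (C := (N * M) ^ 2) hcont.measurable.aestronglyMeasurable
      (Eventually.of_forall fun x => ?_)
    rw [norm_pow, norm_norm]
    refine pow_le_pow_left₀ (norm_nonneg _) ((norm_sum_le_of_le _ fun n _ => hM _).trans ?_) 2
    simp
  -- Chebyshev's inequality at height `(δ * N) ^ 2`; the factor `N ^ 2` cancels against the second
  -- moment.
  have h3 := mul_meas_ge_le_integral_of_nonneg (Eventually.of_forall fun x => sq_nonneg _) hint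
    ((δ * N) ^ 2)
  have h4 : {x | δ * N < ‖∑ n ∈ Finset.Icc 1 N, f (u (a n) • x)‖} ⊆
      {x : SL(2, ℝ) ⧸ Γ | (δ * N) ^ 2 ≤ ‖∑ n ∈ Finset.Icc 1 N, f (u (a n) • x)‖ ^ 2} :=
    fun x hx => pow_le_pow_left₀ (mul_nonneg hδ.le hN0.le) (le_of_lt hx) 2
  refine (measure_mono h4).trans ?_
  rw [← ofReal_measureReal]
  refine ENNReal.ofReal_le_ofReal ?_
  rw [div_mul_eq_mul_div, le_div_iff₀ (by positivity)]
  have h5 : (0 : ℝ) < (N : ℝ) ^ 2 := by positivity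
  nlinarith [h3.trans h2]

/-! ### The exceptional set in the chart -/

/-- Lipschitz bound in the chart for the ergodic sums of a Lipschitz function. -/
lemma exists_norm_sum_chartInv_sub_le {f : SL(2, ℝ) ⧸ Γ → ℂ} {K : ℝ≥0} (hK : LipschitzWith K f) :
    ∃ C c : ℝ, 0 ≤ C ∧ 0 < c ∧ ∀ (x : SL(2, ℝ) ⧸ Γ) (a : ℕ → ℕ) (N : ℕ) (L : ℝ),
      (∀ n ∈ Finset.Icc 1 N, 1 + (a n : ℝ) ^ 2 ≤ L) → ∀ p ∈ Metric.closedBall 0 (1 / 2),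
      ∀ q ∈ Metric.closedBall 0 (1 / 2), L * dist p q ≤ c →
        ‖∑ n ∈ Finset.Icc 1 N, f (u (a n) • chartInv p • x) -
          ∑ n ∈ Finset.Icc 1 N, f (u (a n) • chartInv q • x)‖ ≤ N * (C * (L * dist p q)) := by
  obtain ⟨C, c, hC, hc, hb⟩ := exists_edist_u_smul_chartInv_le
  refine ⟨K * C, c, by positivity, hc, fun x a N L hL p hp q hq hpq => ?_⟩
  rw [← Finset.sum_sub_distrib]
  refine (norm_sum_le_of_le (f := fun n => f (u (a n) • chartInv p • x) -
    f (u (a n) • chartInv q • x)) (n := fun _ => K * C * (L * dist p q)) _ fun n hn => ?_).trans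
    (by simp)
  have h1 : (1 + (a n : ℝ) ^ 2) * dist p q ≤ L * dist p q :=
    mul_le_mul_of_nonneg_right (hL n hn) dist_nonneg
  have h2 := (hK (u (a n) • chartInv p • x) (u (a n) • chartInv q • x)).trans
    (mul_le_mul_right (hb Γ x (a n) p hp q hq (h1.trans hpq)) (K : ℝ≥0∞))
  rw [edist_eq_enorm_sub, ← ofReal_norm, ← ENNReal.ofReal_coe_nnreal,
    ← ENNReal.ofReal_mul (by positivity)] at h2
  have h0 : 0 ≤ (1 + (a n : ℝ) ^ 2) * dist p q := by positivity
  have h3 := (ENNReal.ofReal_le_ofReal_iff (by positivity)).1 h2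
  rw [mul_assoc]
  exact h3.trans (by gcongr)

/-- In the chart at any point, the set where the ergodic averages exceed `ε` infinitely often has
vanishing Hausdorff measure of dimension `3 - β / (4 d)`. -/
theorem hausdorffMeasure_exceptional_chart_eq_zero (μ : Measure (SL(2, ℝ) ⧸ Γ))
    [IsProbabilityMeasure μ] [SMulInvariantMeasure SL(2, ℝ) (SL(2, ℝ) ⧸ Γ) μ]
    {f : SL(2, ℝ) ⧸ Γ → ℂ} {M α β : ℝ} (hM : ∀ x, ‖f x‖ ≤ M) {K : ℝ≥0} (hK : LipschitzWith K f)
    (hmix : PolynomiallyMixing μ (fun x => u 1 • x) f α) (hβ0 : 0 < β) (hβ1 : β < 1) (hβα : β ≤ α)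
    {a : ℕ → ℕ} {d : ℕ} (hd : d ≠ 0) (ha : GrowsPolynomially a d) (x : SL(2, ℝ) ⧸ Γ) {ε : ℝ}
    (hε : 0 < ε) :
    Measure.hausdorffMeasure (3 - β / (4 * d))
      {q : Fin 3 → ℝ | q ∈ Metric.closedBall 0 (1 / 20) ∧ ∃ᶠ N : ℕ in atTop,
        ε * N < ‖∑ n ∈ Finset.Icc 1 N, f (u (a n) • chartInv q • x)‖} = 0 := by
  obtain ⟨hmono, C₁, hC₁, hgrow⟩ := ha
  obtain ⟨C₂, c, hC₂, hc, hlip⟩ := exists_norm_sum_chartInv_sub_le hK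
  obtain ⟨C₃, hC₃, hvol⟩ := exists_volume_le_mul_measure μ x
  obtain ⟨D, hD, hmeas⟩ := exists_measure_lt_norm_sum_le μ hK.continuous hM hmix hβ0.le hβ1 hβα
    hmono (δ := ε / 4) (by positivity)
  have hd1 : (1 : ℝ) ≤ d := by exact_mod_cast Nat.one_le_iff_ne_zero.2 hd
  -- With `m * β > 4`, the factor `T j ^ (-β / 2)` left at the end is at most `(j + 1) ^ (-2)`.
  obtain ⟨m, hm⟩ := exists_nat_gt (4 / β)
  have hmβ : 4 < m * β := (div_lt_iff₀ hβ0).1 hm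
  have hm0 : m ≠ 0 := by rintro rfl; norm_num at hmβ
  -- The three bounds keep the thickening inside the cube of radius `1 / 10`, make the local
  -- Lipschitz estimate applicable, and limit the change of the average to `ε / 4`.
  set c₀ : ℝ := min (1 / 20) (min (c / (1 + C₁ ^ 2)) (ε / 4 / ((C₂ + 1) * (1 + C₁ ^ 2)))) with hc₀
  have hc₀0 : 0 < c₀ := by positivity
  have hc₀1 : c₀ ≤ 1 / 20 := min_le_left _ _
  have hc₀2 : (1 + C₁ ^ 2) * c₀ ≤ c := by
    rw [mul_comm, ← le_div_iff₀ (by positivity)]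
    exact (min_le_right _ _).trans (min_le_left _ _)
  have hc₀3 : C₂ * ((1 + C₁ ^ 2) * c₀) ≤ ε / 4 := by
    have : c₀ ≤ ε / 4 / ((C₂ + 1) * (1 + C₁ ^ 2)) := (min_le_right _ _).trans (min_le_right _ _)
    rw [le_div_iff₀ (by positivity)] at this
    nlinarith [mul_pos (by positivity : 0 < 1 + C₁ ^ 2) hc₀0]
  set T : ℕ → ℕ := fun j => (j + 1) ^ m with hT
  have hT1 : ∀ j, 1 ≤ T j := fun j => Nat.one_le_pow _ _ (Nat.succ_pos j)
  have hT1' : ∀ j, (1 : ℝ) ≤ T j := fun j => by exact_mod_cast hT1 j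
  -- Up to time `T j` the flow expands distances by at most a constant times `1 + a n ^ 2 = O(T j ^
  -- (2 * d))`, which this radius compensates.
  set r : ℕ → ℝ := fun j => c₀ / (T j : ℝ) ^ (2 * d) with hr
  have hTj : ∀ j, j + 1 ≤ T j := fun j => Nat.le_self_pow hm0 _
  have hTmono : Monotone T := fun i j hij => Nat.pow_le_pow_left (Nat.add_le_add_right hij 1) m
  have hr_pos : ∀ j, 0 < r j := fun j => by
    have := hT1' j
    simp only [hr]; positivity
  have hr_le : ∀ j, r j ≤ c₀ := fun j => div_le_self hc₀0.le (one_le_pow₀ (hT1' j))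
  have hr_anti : Antitone r := fun i j hij => by
    have h1 : (T i : ℝ) ≤ T j := by exact_mod_cast hTmono hij
    have := hT1' i
    simp only [hr]
    gcongr
  have hr_lim : Tendsto r atTop (𝓝 0) := by
    refine Tendsto.div_atTop tendsto_const_nhds ?_
    refine (tendsto_pow_atTop (by omega)).comp (tendsto_natCast_atTop_atTop.comp ?_)
    exact tendsto_atTop_mono (fun j => (Nat.le_succ j).trans (hTj j)) tendsto_id
  set F : ℕ → (Fin 3 → ℝ) → ℂ := fun N q =>
    ∑ n ∈ Finset.Icc 1 N, f (u (a n) • chartInv q • x) with hF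
  -- The threshold drops from `ε` to `ε / 2` on passing to the times `T j`, and to `ε / 4` on
  -- thickening.
  set A : ℕ → Set (Fin 3 → ℝ) := fun j =>
    {q | q ∈ Metric.closedBall 0 (1 / 20) ∧ ε / 2 * T j < ‖F (T j) q‖} with hA
  set B : ℕ → Set (Fin 3 → ℝ) := fun j =>
    {q | q ∈ Metric.closedBall 0 (1 / 10) ∧ ε / 4 * T j < ‖F (T j) q‖} with hB
  have hLr : ∀ j, (1 + C₁ ^ 2) * (T j : ℝ) ^ (2 * d) * r j = (1 + C₁ ^ 2) * c₀ := fun j => by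
    have : (T j : ℝ) ^ (2 * d) ≠ 0 := pow_ne_zero _ (by linarith [hT1' j])
    simp only [hr]
    field_simp
  have hL : ∀ j, ∀ n ∈ Finset.Icc 1 (T j),
      1 + (a n : ℝ) ^ 2 ≤ (1 + C₁ ^ 2) * (T j : ℝ) ^ (2 * d) := fun j n hn => by
    obtain ⟨hn1, hn2⟩ := Finset.mem_Icc.1 hn
    have hn2' : (n : ℝ) ≤ T j := by exact_mod_cast hn2
    have h1 : (a n : ℝ) ≤ C₁ * (T j : ℝ) ^ d := (hgrow n hn1).trans (by gcongr)
    have h2 : (a n : ℝ) ^ 2 ≤ (C₁ * (T j : ℝ) ^ d) ^ 2 := by gcongr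
    have h3 : (1 : ℝ) ≤ (T j : ℝ) ^ (2 * d) := one_le_pow₀ (hT1' j)
    rw [mul_pow, ← pow_mul, mul_comm d 2] at h2
    linarith
  have hAB : ∀ j, ∀ p ∈ A j, ∀ q, dist p q ≤ r j → q ∈ B j := fun j p hp q hpq => by
    obtain ⟨hp1, hp2⟩ := hp
    have hq : q ∈ Metric.closedBall 0 (1 / 10) := by
      rw [Metric.mem_closedBall] at hp1 ⊢
      have := dist_triangle q p 0
      rw [dist_comm q p] at this
      linarith [hr_le j]
    have h1 : (1 + C₁ ^ 2) * (T j : ℝ) ^ (2 * d) * dist p q ≤ (1 + C₁ ^ 2) * c₀ := by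
      rw [← hLr j]
      gcongr
    have h2 := hlip x a (T j) _ (hL j) p
      (Metric.closedBall_subset_closedBall (by norm_num) hp1) q
      (Metric.closedBall_subset_closedBall (by norm_num) hq) (h1.trans hc₀2)
    have h3 : ‖F (T j) p - F (T j) q‖ ≤ T j * (ε / 4) :=
      h2.trans (by gcongr; exact (mul_le_mul_of_nonneg_left h1 hC₂).trans hc₀3)
    refine ⟨hq, ?_⟩
    linarith [norm_sub_norm_le (F (T j) p) (F (T j) q)]
  have hfc : ∀ n : ℕ, Continuous fun y : SL(2, ℝ) ⧸ Γ => f (u (a n) • y) := fun n =>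
    hK.continuous.comp (continuous_const_smul _)
  have hBvol : ∀ j, volume (B j) ≤ C₃ * ENNReal.ofReal (D * (T j : ℝ) ^ (-β)) := fun j =>
    (hvol {y | ε / 4 * T j < ‖∑ n ∈ Finset.Icc 1 (T j), f (u (a n) • y)‖}
      (isOpen_lt continuous_const (continuous_finsetSum _ fun n _ => hfc n).norm)).trans
      (mul_le_mul_right (hmeas (T j) (hT1 j)) _)
  -- The codimension `β / (4 * d)` makes the covering factor a multiple of `T j ^ (β / 2)`, half of
  -- which the measure bound `T j ^ (-β)` can absorb with `T j ^ (-β / 2)` to spare.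
  have hterm : ∀ j, ENNReal.ofReal (r j ^ ((3 - β / (4 * d)) - Fintype.card (Fin 3) : ℝ)) *
      volume (B j) ≤
        C₃ * ENNReal.ofReal (c₀ ^ (-(β / (4 * d))) * D * (1 / ((j + 1 : ℕ) : ℝ) ^ 2)) := fun j => by
    have hTp : (0 : ℝ) < T j := by linarith [hT1' j]
    refine (mul_le_mul_right (hBvol j) _).trans ?_
    rw [mul_left_comm, ← ENNReal.ofReal_mul (Real.rpow_nonneg (hr_pos j).le _)]
    refine mul_le_mul_right (ENNReal.ofReal_le_ofReal ?_) _
    have e1 : (3 - β / (4 * d) - Fintype.card (Fin 3) : ℝ) = -(β / (4 * d)) := by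
      simp
    have e2 : r j ^ (-(β / (4 * d))) = c₀ ^ (-(β / (4 * d))) * (T j : ℝ) ^ (β / 2) := by
      simp only [hr]
      rw [Real.div_rpow hc₀0.le (by positivity), ← Real.rpow_natCast, ← Real.rpow_mul hTp.le,
        div_eq_mul_inv, ← Real.rpow_neg hTp.le]
      congr 2
      push_cast
      field_simp
      norm_num
    have e3 : (T j : ℝ) ^ (β / 2) * (T j : ℝ) ^ (-β) ≤ 1 / ((j + 1 : ℕ) : ℝ) ^ 2 := by
      have hj : (1 : ℝ) ≤ (j + 1 : ℕ) := by exact_mod_cast Nat.succ_le_succ (Nat.zero_le j)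
      rw [← Real.rpow_add hTp, show β / 2 + -β = -(β / 2) by ring, Real.rpow_neg hTp.le,
        one_div]
      refine inv_anti₀ (by positivity) ?_
      simp only [hT]
      rw [Nat.cast_pow, ← Real.rpow_natCast _ m, ← Real.rpow_mul (by linarith),
        ← Real.rpow_natCast _ 2]
      exact Real.rpow_le_rpow_of_exponent_le hj (by push_cast; linarith)
    rw [e1, e2]
    calc _ = c₀ ^ (-(β / (4 * d))) * D * ((T j : ℝ) ^ (β / 2) * (T j : ℝ) ^ (-β)) := by ring
      _ ≤ _ := mul_le_mul_of_nonneg_left e3 (mul_nonneg (Real.rpow_nonneg hc₀0.le _) hD)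
  have hsum : ∑' j, ENNReal.ofReal (r j ^ ((3 - β / (4 * d)) - Fintype.card (Fin 3) : ℝ)) *
      volume (B j) ≠ ∞ := by
    refine ne_top_of_le_ne_top ?_ (ENNReal.tsum_le_tsum hterm)
    rw [ENNReal.tsum_mul_left]
    refine ENNReal.mul_ne_top hC₃ (Summable.tsum_ofReal_ne_top ?_)
    refine Summable.mul_left _ ?_
    exact (summable_nat_add_iff 1).2 (Real.summable_one_div_nat_pow.2 one_lt_two)
  have hs : 0 < 3 - β / (4 * d) := by
    have : β / (4 * d) ≤ 1 := (div_le_one (by positivity)).2 (by linarith)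
    linarith
  refine measure_mono_null ?_
    (hausdorffMeasure_frequently_eq_zero hs hr_pos hr_anti hr_lim hAB hsum)
  rintro q ⟨hq, hqN⟩
  have h1 := frequently_average_pow (v := fun n => f (u (a n) • chartInv q • x)) (fun n => hM _)
    (by positivity : 0 ≤ ε / 2) (by linarith) hm0 hqN
  rw [← map_add_atTop_eq_nat 1, frequently_map] at h1
  exact h1.mono fun j hj => ⟨hq, hj⟩

end Horocycle

/-! ### Globalization by countable covers and thresholds. -/

open Horocycle in
theorem theorem1p2 (Γ : Subgroup SL(2, ℝ)) [IsLattice Γ] (d : ℕ) (α : ℝ) (hα : 0 < α) :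
    ∃ α' : ℝ, 0 < α' ∧
      ∀ (μ : Measure (SL(2, ℝ) ⧸ Γ)) [IsProbabilityMeasure μ]
        [SMulInvariantMeasure SL(2, ℝ) (SL(2, ℝ) ⧸ Γ) μ] (f : SL(2, ℝ) ⧸ Γ → ℂ),
      (∃ M : ℝ, ∀ x, ‖f x‖ ≤ M) → (∃ K : ℝ≥0, LipschitzWith K f) →
      ∫ x, f x ∂μ = 0 → PolynomiallyMixing μ (fun x => u 1 • x) f α →
      ∀ a : ℕ → ℕ, GrowsPolynomially a d →
        dimH {x : SL(2, ℝ) ⧸ Γ | 0 < limsup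
          (fun N : ℕ => ‖(1 / (N : ℂ)) * ∑ n ∈ Finset.Icc 1 N, f (u (a n) • x)‖) atTop} ≤
          ENNReal.ofReal (3 - α' / d) := by
  have hβ0 : 0 < min α (1 / 2) := by positivity
  -- Capping at `1 / 2` ensures `β < 1`, as summing the correlations requires. The division by `4`
  -- pairs the quadratic expansion with a loss of half of `β` for summability.
  refine ⟨min α (1 / 2) / 4, by positivity, ?_⟩
  rintro μ _ _ f ⟨M, hM⟩ ⟨K, hK⟩ - hmix a ha
  set β := min α (1 / 2) with hβ
  have hβ1 : β < 1 := (min_le_right _ _).trans_lt (by norm_num)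
  rcases eq_or_ne d 0 with rfl | hd
  -- For `d = 0` the sequence would be bounded, which strict monotonicity excludes.
  · obtain ⟨hmono, C, -, hC⟩ := ha
    obtain ⟨n, hn⟩ := exists_nat_gt C
    have h1 := add_sub_le_of_strictMonoOn hmono le_rfl (Nat.le_add_left 1 n)
    have h2 := hC (n + 1) (Nat.le_add_left 1 n)
    rw [pow_zero, mul_one] at h2
    have h3 : (n : ℝ) ≤ a (n + 1) := by exact_mod_cast (by omega : n ≤ a (n + 1))
    linarith
  obtain ⟨C, c, hC, hc, hlip⟩ := exists_edist_u_smul_chartInv_le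
  -- Two points of a ball of radius `c / 2` are at distance at most `c`, so the chart is Lipschitz
  -- on all of it.
  set ρ : ℝ := min (1 / 20) (c / 2) with hρ
  have hρ0 : 0 < ρ := by positivity
  have hρ1 : ρ ≤ 1 / 20 := min_le_left _ _
  have hρ2 : ρ ≤ c / 2 := min_le_right _ _
  set E : ℕ → Set (SL(2, ℝ) ⧸ Γ) := fun k => {x | ∃ᶠ N : ℕ in atTop,
    1 / ((k : ℝ) + 1) * N < ‖∑ n ∈ Finset.Icc 1 N, f (u (a n) • x)‖} with hE
  set U : SL(2, ℝ) ⧸ Γ → Set (SL(2, ℝ) ⧸ Γ) := fun x =>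
    (fun q => chartInv q • x) '' Metric.closedBall 0 ρ with hU
  have hUn : ∀ x, U x ∈ 𝓝 x := fun x => by
    have hone : (1 : SL(2, ℝ)) ∈ chart ⁻¹' Metric.ball 0 ρ := by
      have : chart 1 = 0 := by
        funext i
        fin_cases i <;> simp [chart]
      simp [this, hρ0]
    refine mem_of_superset ((isOpen_image_smul x
      (Metric.isOpen_ball.preimage continuous_chart)).mem_nhds ⟨1, hone, one_smul _ x⟩) ?_
    rintro _ ⟨g, hg, rfl⟩
    have hg' := Metric.ball_subset_closedBall hg
    refine ⟨chart g, hg', ?_⟩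
    have h1 := (mem_closedBall_fin_three.1 hg').1
    simp only [chartInv_chart (g := g) (h1.trans (by linarith))]
  obtain ⟨S, hS, hcov⟩ := TopologicalSpace.countable_cover_nhds hUn
  have hs0 : 0 ≤ 3 - β / (4 * d) := by
    have hd1 : (1 : ℝ) ≤ d := by exact_mod_cast Nat.one_le_iff_ne_zero.2 hd
    have : β / (4 * d) ≤ 1 := (div_le_one (by positivity)).2 (by linarith)
    linarith
  have hlocal : ∀ x k, dimH (E k ∩ U x) ≤ ENNReal.ofReal (3 - β / 4 / d) := fun x k => by
    set Q : Set (Fin 3 → ℝ) := {q | q ∈ Metric.closedBall 0 (1 / 20) ∧ ∃ᶠ N : ℕ in atTop,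
      1 / ((k : ℝ) + 1) * N < ‖∑ n ∈ Finset.Icc 1 N, f (u (a n) • chartInv q • x)‖} with hQ
    have hQ0 : Measure.hausdorffMeasure (3 - β / (4 * d)) Q = 0 :=
      hausdorffMeasure_exceptional_chart_eq_zero μ hM hK hmix hβ0 hβ1 (min_le_left _ _) hd ha x
        (by positivity)
    have hQd : dimH Q ≤ ENNReal.ofReal (3 - β / 4 / d) := by
      have h1 := dimH_le_of_hausdorffMeasure_ne_top (s := Q) (d := (3 - β / (4 * d)).toNNReal)
        (by rw [Real.coe_toNNReal _ hs0, hQ0]; exact ENNReal.zero_ne_top)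
      rwa [div_div]
    -- This is the expansion estimate at time `0`; a Lipschitz map does not raise dimension.
    have hLip : LipschitzOnWith C.toNNReal (fun q => chartInv q • x) (Metric.closedBall 0 ρ) := by
      intro p hp q hq
      have hdist : dist p q ≤ c := by
        have := dist_triangle_right p q 0
        rw [Metric.mem_closedBall] at hp hq
        linarith
      have hsub : Metric.closedBall (0 : Fin 3 → ℝ) ρ ⊆ Metric.closedBall 0 (1 / 2) :=
        Metric.closedBall_subset_closedBall (by linarith)
      have := hlip Γ x 0 p (hsub hp) q (hsub hq) (by simpa using hdist)
      rw [u_zero, one_smul, one_smul] at this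
      refine this.trans (le_of_eq ?_)
      rw [ENNReal.ofReal_mul hC, edist_dist]
      norm_num
      rfl
    have hsub : E k ∩ U x ⊆ (fun q => chartInv q • x) '' (Q ∩ Metric.closedBall 0 ρ) := by
      rintro _ ⟨hy, q, hq, rfl⟩
      exact ⟨q, ⟨⟨Metric.closedBall_subset_closedBall hρ1 hq, hy⟩, hq⟩, rfl⟩
    exact (dimH_mono hsub).trans (((hLip.mono Set.inter_subset_right).dimH_image_le).trans
      ((dimH_mono Set.inter_subset_left).trans hQd))
  have hsub : {x : SL(2, ℝ) ⧸ Γ | 0 < limsup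
      (fun N : ℕ => ‖(1 / (N : ℂ)) * ∑ n ∈ Finset.Icc 1 N, f (u (a n) • x)‖) atTop} ⊆
      ⋃ k, ⋃ x ∈ S, E k ∩ U x := by
    intro y hy
    obtain ⟨k, hk⟩ := exists_nat_one_div_lt (K := ℝ) hy
    have hfreq := frequently_lt_of_lt_limsup
      (isCoboundedUnder_le_of_le atTop (x := 0) fun N => norm_nonneg _) hk
    obtain ⟨x, hxS, hyx⟩ : ∃ x ∈ S, y ∈ U x := by
      have : y ∈ ⋃ x ∈ S, U x := hcov ▸ Set.mem_univ y
      simpa using this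
    refine Set.mem_iUnion.2 ⟨k, Set.mem_biUnion hxS ⟨?_, hyx⟩⟩
    -- Restricting to `N > 0` allows clearing the denominator.
    refine (hfreq.and_eventually (eventually_gt_atTop 0)).mono fun N ⟨hN, hN0⟩ => ?_
    have hN0' : (0 : ℝ) < N := by exact_mod_cast hN0
    rw [norm_mul, norm_div, norm_one, Complex.norm_natCast, one_div_mul_eq_div,
      lt_div_iff₀ hN0'] at hN
    exact hN
  refine (dimH_mono hsub).trans ?_
  rw [dimH_iUnion]
  refine iSup_le fun k => ?_
  rw [dimH_bUnion hS]
  exact iSup₂_le fun x _ => hlocal x k
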